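/- Let $m\ge \ell\ge 3$ be integers, $\alpha=\ell/m$, and let $h_2$ be the binary entropy function. For $0<\beta<1$ (with $\beta<1-1/m$ if $m$ is odd) the equation $$\frac{(1+t)^{m-1}+(1-t)^{m-1}}{(1+t)^{m}+(1-t)^{m}}=1-\beta$$ has a unique positive root $t=t(\beta)$. Put $$q(\alpha,\beta)=\alpha\log_2\frac{(1+t)^m+(1-t)^m}{2t^{\beta m}}-\alpha m\,h_2(\beta),$$ and $q(\alpha,\beta)=-\infty$ if $m$ is odd and $\beta\ge 1-1/m$. For $0<\theta\le 1$ let $$f(\theta)=\sup_{0<\beta<1}\{q(\alpha,\beta\theta)+\theta h_2(\beta)\}.$$ Let $\mathbb A(\ell,m)$ be the ensemble of binary codes of length $n$ given by the equiprobable $r\times n$ parity-check matrices with all columns of weight $\ell$ and all rows of weight $m=\ell n/r$. Let $\mathbb B(\ell,m)$ be the (Gallager) ensemble of binary codes of length $n=ms$ whose parity-check matrices consist of $\ell$ horizontal blocks of size $s\times n$, where each block is obtained from the concatenation of $m$ unit matrices of size $s\times s$ by an independent uniformly random permutation of the $n$ columns. For a code $C$ of length $n$ and a set of positions $J$ with complement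 $I$, the shortened code is $C_J=\{c_J: c\in C,\ c_I=0\}$, and its null-free size is the number of its non-zero words. Let $N_\theta$ be the average null-free size of $C_J$ over the ensemble. Then for each of the two ensembles, as $n\to\infty$ along admissible lengths ($m\mid \ell n$ for $\mathbb A$, $m\mid n$ for $\mathbb B$), and for any subsets $J=J_n$ of positions of size $\theta n$ (more generally with $|J_n|/n\to\theta$), $N_\theta$ is positive for all large $n$ and $$\lim_{n\to\infty}\tfrac1n\log_2N_\theta=f(\theta).$$ -/

import Mathlib

open Filter Topology Finset

noncomputable section

namespace LDPC

/-- The binary linear code with parity-check matrix `H`. -/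
def code {ι : Type*} {n : ℕ} (H : Matrix ι (Fin n) (ZMod 2)) :
    Submodule (ZMod 2) (Fin n → ZMod 2) :=
  LinearMap.ker H.mulVecLin

/-- The shortened code `C_J = {c_J : c ∈ C, c_I = 0}`, where `I` is the complement of `J`;
it is a linear code on the set of positions `J`. -/
def shortened {n : ℕ} (C : Submodule (ZMod 2) (Fin n → ZMod 2)) (J : Finset (Fin n)) :
    Set (J → ZMod 2) :=
  {u | ∃ c ∈ C, (∀ i, i ∉ J → c i = 0) ∧ ∀ i : J, u i = c i}

/-- The null-free size of a code: the number of its non-zero words. -/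
def nullFreeSize {κ : Type*} (C : Set (κ → ZMod 2)) : ℕ :=
  Set.ncard {u | u ∈ C ∧ u ≠ 0}

/-- The parity-check matrices of the ensemble `𝔸(ℓ, m)`: all binary `r × n` matrices
with all columns of Hamming weight `ℓ` and all rows of Hamming weight `m`. -/
def matricesA (ℓ m r n : ℕ) : Finset (Matrix (Fin r) (Fin n) (ZMod 2)) :=
  Finset.univ.filter fun H =>
    (∀ i, hammingNorm (fun j => H i j) = m) ∧ (∀ j, hammingNorm (fun i => H i j) = ℓ)

/-- The null-free size of the shortened code `C_J`, averaged over the equiprobable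
parity-check matrices of `𝔸(ℓ, m)`. -/
def avgSizeA (ℓ m r n : ℕ) (J : Finset (Fin n)) : ℝ :=
  (∑ H ∈ matricesA ℓ m r n, (nullFreeSize (shortened (code H) J) : ℝ)) /
    ((matricesA ℓ m r n).card : ℝ)

/-- The first block of a Gallager matrix: `m` consecutive unit matrices of size `s × s`. -/
def unitBlock (m s : ℕ) : Matrix (Fin s) (Fin (m * s)) (ZMod 2) :=
  fun a j => if (j : ℕ) % s = (a : ℕ) then 1 else 0

/-- The parity-check matrix of length `n = m * s` of the ensemble `𝔹(ℓ, m)` given by the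
permutations `π 0, …, π (ℓ - 1)` of the columns: `ℓ` horizontal blocks of size `s × n`
(the row `(i, a)` is the row `a` of the block `i`), the block `i` being the first
block with its columns permuted by `π i`. -/
def gallagerMatrix (ℓ m s : ℕ) (π : Fin ℓ → Equiv.Perm (Fin (m * s))) :
    Matrix (Fin ℓ × Fin s) (Fin (m * s)) (ZMod 2) :=
  fun p j => unitBlock m s p.2 (π p.1 j)

/-- The null-free size of the shortened code `C_J`, averaged over the ensemble `𝔹(ℓ, m)`
of length `m * s`, that is, over `ℓ` independent uniform permutations of the columns. -/
def avgSizeB (ℓ m s : ℕ) (J : Finset (Fin (m * s))) : ℝ :=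
  (∑ π : Fin ℓ → Equiv.Perm (Fin (m * s)),
      (nullFreeSize (shortened (code (gallagerMatrix ℓ m s π)) J) : ℝ)) /
    (Fintype.card (Fin ℓ → Equiv.Perm (Fin (m * s))) : ℝ)

/-- The binary entropy function (in bits). -/
def h₂ (x : ℝ) : ℝ := Real.binEntropy x / Real.log 2

/-- `t` is a positive root of the equation that defines `t` as a function of `β`. -/
def IsPosRoot (m : ℕ) (β t : ℝ) : Prop :=
  0 < t ∧
    ((1 + t) ^ (m - 1) + (1 - t) ^ (m - 1)) / ((1 + t) ^ m + (1 - t) ^ m) = 1 - β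

/-- The positive root `t` as a function of `β` (arbitrary where there is none). -/
def root (m : ℕ) (β : ℝ) : ℝ := Classical.epsilon (IsPosRoot m β)

/-- The exponent `q(α, β)`, equal to `-∞` if `m` is odd and `β ≥ 1 - 1/m`. -/
def q (m : ℕ) (α β : ℝ) : EReal :=
  open Classical in
  if Odd m ∧ 1 - 1 / (m : ℝ) ≤ β then ⊥
  else
    ((α * Real.logb 2
        (((1 + root m β) ^ m + (1 - root m β) ^ m) / (2 * root m β ^ (β * (m : ℝ))))
      - α * m * h₂ β : ℝ) : EReal)

/-- `f(θ) = sup_{0 < β < 1} (q(α, β θ) + θ h₂(β))` with `α = ℓ / m`. -/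
def f (ℓ m : ℕ) (θ : ℝ) : EReal :=
  ⨆ β ∈ Set.Ioo (0 : ℝ) 1,
    (q m ((ℓ : ℝ) / (m : ℝ)) (β * θ) + ((θ * h₂ β : ℝ) : EReal))

end LDPC

end

/-! A nonzero word of the shortened code is the indicator of a nonempty S ⊆ J on which every check
is even. The average null-free size is therefore the sum over such S of the probability that a
random matrix checks S (`nullFreeSize_shortened`, `avgSizeB_eq`, `avgSizeA_eq`).

A Gallager block assigns to each position one of s letters, each used m times. By double counting
under permutations (`card_even_mul_choose`), a set of size w is even for it with probability `evenWt
m s w` / C(ms, w), and the ℓ blocks are independent. For 𝔸, a matrix is replaced by a word on n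
columns of ℓ positions, with r letters each used m times. The same count gives `evenWt m r (ℓw)` /
C(mr, ℓw) for random words, and the words without a repeated letter in a column represent each
matrix ℓ!^n times. A switching argument (`card_evenWords_le`) shows that discarding the other words
costs only a polynomial factor.

The numbers `evenWt m r k` are the coefficients of `gen m t ^ r`. Each t > 0 gives an upper bound
for a coefficient. The positive root t is the saddle point: there the mean weight is βm, the tails
of `gen m t ^ r` are exponentially small, and a coefficient of nearby index attains the bound up to
a subexponential factor (`exists_evenWt_mul_pow_ge`, `exists_evenWt_ge`). With Stirling's formula
both ensembles acquire the same exponent `rate`.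

It remains to sum over w with the factor C(|J|, w). One weight near βθn gives the lower bound for
each β (`eventually_le_sum`). For the upper bound, `exists_rate_lt` supplies a good t at every
relative weight, even where no root exists, and compactness makes the estimate uniform
(`eventually_sum_le`). -/

namespace LDPC

/-! ### Words with prescribed letter multiplicities and their even sets -/

section Words

lemma exists_perm_map_eq {Y : Type*} [Fintype Y] [DecidableEq Y] {S T : Finset Y}
    (h : S.card = T.card) : ∃ τ : Equiv.Perm Y, S.map τ.toEmbedding = T := by
  refine ⟨(Finset.equivOfCardEq h).extendSubtype, eq_of_subset_of_card_le (fun y hy => ?_) ?_⟩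
  · obtain ⟨x, hx, rfl⟩ := mem_map.1 hy
    exact (Finset.equivOfCardEq h).extendSubtype_mem x hx
  · rw [card_map, h]

variable {Y R : Type*} [DecidableEq R]

/-- Every fibre of `w` meets `S` in an even number of points. -/
def IsEvenOn (w : Y → R) (S : Finset Y) : Prop :=
  ∀ i, Even ({y ∈ S | w y = i} : Finset Y).card

instance [Fintype R] (w : Y → R) (S : Finset Y) : Decidable (IsEvenOn w S) := by
  unfold IsEvenOn; infer_instance

lemma isEvenOn_comp (w : Y → R) (τ : Equiv.Perm Y) (S : Finset Y) :
    IsEvenOn (w ∘ τ) S ↔ IsEvenOn w (S.map τ.toEmbedding) := by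
  refine forall_congr' fun i => ?_
  rw [filter_map, card_map]
  rfl

variable [Fintype R]

lemma card_eq_sum_fiber (w : Y → R) (S : Finset Y) :
    S.card = ∑ i, ({y ∈ S | w y = i} : Finset Y).card :=
  card_eq_sum_card_fiberwise (fun _ _ => mem_coe.2 (mem_univ _))

variable [Fintype Y] [DecidableEq Y]

/-- The functions `Y → R` all of whose fibres have size `m`. -/
def words (Y R : Type*) [Fintype Y] [DecidableEq Y] [Fintype R] [DecidableEq R] (m : ℕ) :
    Finset (Y → R) :=
  {w | ∀ i, ({y | w y = i} : Finset Y).card = m}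

lemma mem_words {m : ℕ} {w : Y → R} :
    w ∈ words Y R m ↔ ∀ i, ({y | w y = i} : Finset Y).card = m := by
  simp [words]

/-- The families of even numbers `≤ m` indexed by `Fin r`. -/
def evenTypes (m r : ℕ) : Finset (Fin r → ℕ) :=
  Fintype.piFinset fun _ => (range (m + 1)).filter Even

/-- The number of subsets of size `k` of `r` disjoint sets of size `m` that meet each of them in an
even number of points. -/
def evenWt (m r k : ℕ) : ℕ :=
  ∑ a ∈ (evenTypes m r).filter (fun a => ∑ i, a i = k), ∏ i, m.choose (a i)

lemma card_subsets_of_fiber_card (w : Y → R) (a : R → ℕ) :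
    (univ.filter fun S : Finset Y => ∀ i, ({y ∈ S | w y = i} : Finset Y).card = a i).card =
      ∏ i, ({y | w y = i} : Finset Y).card.choose (a i) := by
  have : ∏ i, ({y | w y = i} : Finset Y).card.choose (a i) =
      (Fintype.piFinset fun i => powersetCard (a i) ({y | w y = i} : Finset Y)).card := by
    simp [Fintype.card_piFinset]
  rw [this]
  refine card_bij' (fun S _ i => {y ∈ S | w y = i}) (fun T _ => univ.biUnion T) ?_ ?_ ?_ ?_
  · intro S hS
    simp only [mem_filter, mem_univ, true_and] at hS
    simp only [Fintype.mem_piFinset, mem_powersetCard]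
    exact fun i => ⟨filter_subset_filter _ (subset_univ _), hS i⟩
  · intro T hT
    simp only [Fintype.mem_piFinset, mem_powersetCard] at hT
    simp only [mem_filter, mem_univ, true_and]
    intro i
    rw [← (hT i).2]
    congr 1
    ext y
    simp only [mem_filter, mem_biUnion, mem_univ, true_and]
    constructor
    · rintro ⟨⟨j, hj⟩, rfl⟩
      have := (hT j).1 hj
      simp only [mem_filter, mem_univ, true_and] at this
      rwa [this]
    · intro hy
      exact ⟨⟨i, hy⟩, by simpa using (hT i).1 hy⟩
  · intro S _
    ext y
    simp
  · intro T hT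
    simp only [Fintype.mem_piFinset, mem_powersetCard] at hT
    funext i
    ext y
    simp only [mem_filter, mem_biUnion, mem_univ, true_and]
    constructor
    · rintro ⟨⟨j, hj⟩, rfl⟩
      have := (hT j).1 hj
      simp only [mem_filter, mem_univ, true_and] at this
      rwa [this]
    · intro hy
      exact ⟨⟨i, hy⟩, by simpa using (hT i).1 hy⟩

lemma card_even_subsets {m r : ℕ} {w : Y → Fin r} (hw : w ∈ words Y (Fin r) m) (k : ℕ) :
    ((powersetCard k univ).filter (IsEvenOn w)).card = evenWt m r k := by
  rw [mem_words] at hw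
  rw [evenWt, card_eq_sum_card_fiberwise
    (f := fun S i => ({y ∈ S | w y = i} : Finset Y).card)
    (t := (evenTypes m r).filter (fun a => ∑ i, a i = k))]
  · refine sum_congr rfl fun a ha => ?_
    simp only [evenTypes, mem_filter, Fintype.mem_piFinset, mem_range] at ha
    rw [← prod_congr rfl fun i _ => by rw [← hw i], ← card_subsets_of_fiber_card]
    congr 1
    ext S
    simp only [mem_filter, mem_powersetCard, subset_univ, true_and, mem_univ]
    constructor
    · rintro ⟨_, h⟩ i
      exact congrFun h i
    · intro h
      refine ⟨⟨?_, fun i => ?_⟩, funext h⟩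
      · rw [card_eq_sum_fiber w, sum_congr rfl fun i _ => h i, ha.2]
      · rw [h i]; exact (ha.1 i).2
  · intro S hS
    simp only [coe_filter, mem_powersetCard, subset_univ, true_and, Set.mem_ofPred_eq] at hS
    simp only [evenTypes, coe_filter, Fintype.mem_piFinset, mem_filter, mem_range,
      Set.mem_ofPred_eq]
    refine ⟨fun i => ⟨?_, hS.2 i⟩, ?_⟩
    · rw [← hw i]
      exact Nat.lt_succ_of_le (card_le_card (filter_subset_filter _ (subset_univ _)))
    · rw [← hS.1, card_eq_sum_fiber w]

/-- Double counting: in a permutation-invariant family of words, the proportion of words that are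
even on a given set is the proportion of even sets for a given word. -/
lemma card_even_mul_choose {m r : ℕ} {α : Type*} (Ω : Finset α) (wd : α → Y → Fin r)
    (hwd : ∀ ω ∈ Ω, wd ω ∈ words Y (Fin r) m)
    (hinv : ∀ τ : Equiv.Perm Y, ∃ e : Equiv.Perm α, ∀ ω, (e ω ∈ Ω ↔ ω ∈ Ω) ∧ wd (e ω) = wd ω ∘ τ)
    (S : Finset Y) :
    (Ω.filter fun ω => IsEvenOn (wd ω) S).card * (Fintype.card Y).choose S.card =
      Ω.card * evenWt m r S.card := by
  have hsymm : ∀ T ∈ powersetCard S.card (univ : Finset Y),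
      (Ω.filter fun ω => IsEvenOn (wd ω) T).card = (Ω.filter fun ω => IsEvenOn (wd ω) S).card := by
    intro T hT
    obtain ⟨τ, rfl⟩ := exists_perm_map_eq (mem_powersetCard.1 hT).2.symm
    obtain ⟨e, he⟩ := hinv τ
    symm
    refine card_bij' (fun ω _ => e.symm ω) (fun ω _ => e ω) ?_ ?_ (by simp) (by simp)
    · intro ω hω
      obtain ⟨h1, h2⟩ := he (e.symm ω)
      rw [e.apply_symm_apply] at h1 h2
      rw [mem_filter] at hω ⊢
      rw [h2, isEvenOn_comp] at hω
      exact ⟨h1.1 hω.1, hω.2⟩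
    · intro ω hω
      obtain ⟨h1, h2⟩ := he ω
      rw [mem_filter] at hω ⊢
      rw [h2, isEvenOn_comp]
      exact ⟨h1.2 hω.1, hω.2⟩
  have h1 : ∑ T ∈ powersetCard S.card (univ : Finset Y),
      (Ω.filter fun ω => IsEvenOn (wd ω) T).card = ∑ ω ∈ Ω, evenWt m r S.card := by
    rw [sum_congr rfl fun ω hω => (card_even_subsets (hwd ω hω) S.card).symm]
    exact sum_card_bipartiteAbove_eq_sum_card_bipartiteBelow (r := fun T ω => IsEvenOn (wd ω) T)
  rw [sum_congr rfl hsymm] at h1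
  simpa [mul_comm] using h1

end Words

/-! ### Switching: removing repeated letters from columns -/

section Switching

variable {V : Type*} [Fintype V] [DecidableEq V] {ℓ m r : ℕ}

/-- The words of `r` letters, each used `m` times, whose positions are grouped in columns of size
`ℓ`, that are even on the union of the columns in `S`. -/
def evenWords (ℓ m r : ℕ) (S : Finset V) : Finset (V × Fin ℓ → Fin r) :=
  (words (V × Fin ℓ) (Fin r) m).filter fun w => IsEvenOn w (S ×ˢ univ)

/-- The pairs of positions in the same column that carry the same letter. -/
def badPairs (w : V × Fin ℓ → Fin r) : Finset ((V × Fin ℓ) × (V × Fin ℓ)) :=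
  {p | p.1 ≠ p.2 ∧ p.1.1 = p.2.1 ∧ w p.1 = w p.2}

lemma comp_perm_mem_words {Y R : Type*} [Fintype Y] [DecidableEq Y] [Fintype R] [DecidableEq R]
    {m : ℕ} {w : Y → R} (hw : w ∈ words Y R m) (τ : Equiv.Perm Y) : w ∘ τ ∈ words Y R m := by
  rw [mem_words] at hw ⊢
  intro i
  rw [← hw i]
  exact card_bij' (fun y _ => τ y) (fun y _ => τ.symm y) (by simp) (by simp) (by simp) (by simp)

lemma map_swap_eq {Y : Type*} [DecidableEq Y] {T : Finset Y} {y z : Y} (h : y ∈ T ↔ z ∈ T) :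
    T.map (Equiv.swap y z).toEmbedding = T := by
  refine eq_of_subset_of_card_le (fun x hx => ?_) (by rw [card_map])
  obtain ⟨u, hu, rfl⟩ := mem_map.1 hx
  simp only [Equiv.toEmbedding_apply, Equiv.swap_apply_def]
  split_ifs with h1 h2
  · exact h.1 (h1 ▸ hu)
  · exact h.2 (h2 ▸ hu)
  · exact hu

lemma comp_swap_mem_evenWords {S : Finset V} {w : V × Fin ℓ → Fin r}
    (hw : w ∈ evenWords ℓ m r S) {y z : V × Fin ℓ} (h : y.1 ∈ S ↔ z.1 ∈ S) :
    w ∘ Equiv.swap y z ∈ evenWords ℓ m r S := by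
  rw [evenWords, mem_filter] at hw ⊢
  refine ⟨comp_perm_mem_words hw.1 _, ?_⟩
  rw [isEvenOn_comp, map_swap_eq (by simpa using h)]
  exact hw.2

/-- The positions in the columns of the same kind (in `S` or not) as the position `y`. -/
def sameSide (S : Finset V) (y : V × Fin ℓ) : Finset (V × Fin ℓ) :=
  {z | y.1 ∈ S ↔ z.1 ∈ S}

/-- Exchanging y' with another z on the same side fixes y and preserves `evenWords`, so the
collision y, z is as frequent as y, y'. Summed over z ≠ y, a word is counted at most m times, since
its letter at y has only m positions. -/
lemma card_collision_le {S : Finset V} {y y' : V × Fin ℓ} (hne : y ≠ y')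
    (hS : y.1 ∈ S ↔ y'.1 ∈ S) :
    ((evenWords ℓ m r S).filter fun w => w y = w y').card * ((sameSide S y).card - 1) ≤
      (evenWords ℓ m r S).card * m := by
  have hsymm : ∀ z ∈ (sameSide S y).erase y,
      ((evenWords ℓ m r S).filter fun w => w y = w z).card =
        ((evenWords ℓ m r S).filter fun w => w y = w y').card := by
    intro z hz
    simp only [sameSide, mem_erase, mem_filter, mem_univ, true_and] at hz
    have hs : y'.1 ∈ S ↔ z.1 ∈ S := hS.symm.trans hz.2
    have hy : Equiv.swap y' z y = y := Equiv.swap_apply_of_ne_of_ne hne hz.1.symm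
    refine card_bij' (fun w _ => w ∘ Equiv.swap y' z) (fun w _ => w ∘ Equiv.swap y' z)
      ?_ ?_ ?_ ?_
    · intro w hw
      rw [mem_filter] at hw ⊢
      exact ⟨comp_swap_mem_evenWords hw.1 hs, by simp [hy, hw.2]⟩
    · intro w hw
      rw [mem_filter] at hw ⊢
      exact ⟨comp_swap_mem_evenWords hw.1 hs, by simp [hy, hw.2]⟩
    · intro w _; ext; simp
    · intro w _; ext; simp
  have hcount : ∑ z ∈ (sameSide S y).erase y,
      ((evenWords ℓ m r S).filter fun w => w y = w z).card ≤ (evenWords ℓ m r S).card * m := by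
    have := sum_card_bipartiteAbove_eq_sum_card_bipartiteBelow
      (s := (sameSide S y).erase y) (t := evenWords ℓ m r S) (r := fun z w => w y = w z)
    simp only [bipartiteAbove, bipartiteBelow] at this
    rw [this, ← smul_eq_mul, ← sum_const]
    refine sum_le_sum fun w hw => ?_
    rw [evenWords, mem_filter, mem_words] at hw
    rw [← hw.1 (w y)]
    refine card_le_card fun z hz => ?_
    simp only [mem_filter, mem_univ, true_and] at hz ⊢
    exact hz.2.symm
  rw [sum_congr rfl hsymm, sum_const, card_erase_of_mem (by simp [sameSide]), smul_eq_mul,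
    mul_comm] at hcount
  exact hcount

lemma card_sameSide (S : Finset V) (y : V × Fin ℓ) :
    (sameSide S y).card = (if y.1 ∈ S then S.card else Sᶜ.card) * ℓ := by
  have : sameSide S y = (if y.1 ∈ S then S else Sᶜ) ×ˢ (univ : Finset (Fin ℓ)) := by
    ext z
    by_cases h : y.1 ∈ S <;> simp [sameSide, h]
  rw [this, card_product]
  split_ifs <;> simp

/-- The number of bad pairs is bounded on average. -/
lemma sum_card_badPairs_le {S : Finset V} (hℓ : 2 ≤ ℓ) :
    ∑ w ∈ evenWords ℓ m r S, (badPairs w).card ≤ 4 * ℓ * m * (evenWords ℓ m r S).card := by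
  have hside : ∀ y : V × Fin ℓ, 2 ≤ (sameSide S y).card := by
    intro y
    rw [card_sameSide]
    have : 0 < if y.1 ∈ S then S.card else Sᶜ.card := by
      split_ifs with h
      · exact card_pos.2 ⟨_, h⟩
      · exact card_pos.2 ⟨y.1, by simpa⟩
    nlinarith
  -- A side has at least two positions because ℓ ≥ 2, so its size minus one is at least half its
  -- size; this is the factor 2.
  have hpair : ∀ y y' : V × Fin ℓ, y ≠ y' → y.1 = y'.1 →
      ((evenWords ℓ m r S).filter fun w => w y = w y').card * (sameSide S y).card ≤
      2 * ((evenWords ℓ m r S).card * m) := by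
    intro y y' hne h
    have h1 := card_collision_le (m := m) (r := r) hne (S := S) (by rw [h])
    have h2 := hside y
    obtain ⟨c, hc⟩ : ∃ c, (sameSide S y).card = c + 1 := ⟨_, (Nat.succ_pred_eq_of_pos (by omega)).symm⟩
    rw [hc] at h1 h2 ⊢
    rw [Nat.add_sub_cancel] at h1
    nlinarith
  -- Each of the two sides contributes at most 1.
  have hinv : ∑ y : V × Fin ℓ, (1 : ℝ) / (sameSide S y).card ≤ 2 := by
    have hℓ0 : (ℓ : ℝ) ≠ 0 := by positivity
    have h1 : ∀ T : Finset V, ∑ _v ∈ T, (1 : ℝ) / T.card ≤ 1 := by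
      intro T
      rw [sum_const, nsmul_eq_mul, mul_one_div]
      exact div_self_le_one _
    calc ∑ y : V × Fin ℓ, (1 : ℝ) / (sameSide S y).card
        = ∑ v : V, (1 : ℝ) / (if v ∈ S then S.card else Sᶜ.card : ℕ) := by
          rw [Fintype.sum_prod_type]
          refine sum_congr rfl fun v _ => ?_
          rw [sum_congr rfl (g := fun _ =>
            (1 : ℝ) / ((if v ∈ S then S.card else Sᶜ.card) * ℓ : ℕ))
            (fun a _ => by rw [card_sameSide]), sum_const, card_univ, Fintype.card_fin, nsmul_eq_mul, Nat.cast_mul]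
          field_simp
      _ = ∑ v ∈ S, (1 : ℝ) / S.card + ∑ v ∈ Sᶜ, (1 : ℝ) / Sᶜ.card := by
          rw [← sum_add_sum_compl S]
          congr 1
          · exact sum_congr rfl fun v hv => by rw [if_pos hv]
          · exact sum_congr rfl fun v hv => by rw [if_neg (mem_compl.1 hv)]
      _ ≤ 2 := by linarith [h1 S, h1 Sᶜ]
  have hcol : ∀ y : V × Fin ℓ,
      (({y' | y ≠ y' ∧ y.1 = y'.1} : Finset (V × Fin ℓ)).card : ℝ) ≤ ℓ := by
    intro y
    have : ({y' | y ≠ y' ∧ y.1 = y'.1} : Finset (V × Fin ℓ)) ⊆ {y.1} ×ˢ univ := by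
      intro z hz
      simp only [mem_filter, mem_univ, true_and] at hz
      simp [hz.2]
    exact_mod_cast (card_le_card this).trans (by simp)
  have hsum : ∑ w ∈ evenWords ℓ m r S, (badPairs w).card =
      ∑ y : V × Fin ℓ, ∑ y' ∈ ({y' | y ≠ y' ∧ y.1 = y'.1} : Finset (V × Fin ℓ)),
        ((evenWords ℓ m r S).filter fun w => w y = w y').card := by
    simp only [badPairs, card_filter, sum_filter]
    rw [sum_comm, Fintype.sum_prod_type]
    refine sum_congr rfl fun y _ => sum_congr rfl fun y' _ => ?_
    by_cases h : y ≠ y' ∧ y.1 = y'.1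
    · simp [h]
    · rw [if_neg h]
      exact sum_eq_zero fun w _ => if_neg fun h' => h ⟨h'.1, h'.2.1⟩
  have : (∑ w ∈ evenWords ℓ m r S, (badPairs w).card : ℝ) ≤
      4 * ℓ * m * (evenWords ℓ m r S).card := by
    calc (∑ w ∈ evenWords ℓ m r S, (badPairs w).card : ℝ)
        = ∑ y : V × Fin ℓ, ∑ y' ∈ ({y' | y ≠ y' ∧ y.1 = y'.1} : Finset (V × Fin ℓ)),
        (((evenWords ℓ m r S).filter fun w => w y = w y').card : ℝ) := by exact_mod_cast hsum
      _ ≤ ∑ y : V × Fin ℓ, ∑ y' ∈ ({y' | y ≠ y' ∧ y.1 = y'.1} : Finset (V × Fin ℓ)),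
          2 * ((evenWords ℓ m r S).card * m) * ((1 : ℝ) / (sameSide S y).card) := by
          refine sum_le_sum fun y _ => sum_le_sum fun y' hy' => ?_
          simp only [mem_filter, mem_univ, true_and] at hy'
          have h0 : (0 : ℝ) < (sameSide S y).card := by
            exact_mod_cast (by linarith [hside y] : 0 < (sameSide S y).card)
          rw [mul_one_div, le_div_iff₀ h0]
          exact_mod_cast hpair y y' hy'.1 hy'.2
      _ ≤ ∑ y : V × Fin ℓ,
          (ℓ : ℝ) * (2 * ((evenWords ℓ m r S).card * m) * ((1 : ℝ) / (sameSide S y).card)) := by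
          refine sum_le_sum fun y _ => ?_
          rw [sum_const, nsmul_eq_mul]
          exact mul_le_mul_of_nonneg_right (hcol y) (by positivity)
      _ = ℓ * (2 * ((evenWords ℓ m r S).card * m)) *
          ∑ y : V × Fin ℓ, (1 : ℝ) / (sameSide S y).card := by
          rw [mul_sum]
          exact sum_congr rfl fun y _ => by ring
      _ ≤ ℓ * (2 * ((evenWords ℓ m r S).card * m)) * 2 :=
          mul_le_mul_of_nonneg_left hinv (by positivity)
      _ = _ := by ring
  exact_mod_cast this

/-- If both kinds of columns are either absent or numerous, a word with a bad pair can be improved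
by exchanging two letters. -/
lemma exists_swap_card_badPairs_lt {S : Finset V} (hS : S.card = 0 ∨ 2 * m < S.card)
    (hS' : Sᶜ.card = 0 ∨ 2 * m < Sᶜ.card) {w : V × Fin ℓ → Fin r} (hw : w ∈ evenWords ℓ m r S)
    (hbad : (badPairs w).Nonempty) :
    ∃ y z : V × Fin ℓ, w ∘ Equiv.swap y z ∈ evenWords ℓ m r S ∧
      (badPairs (w ∘ Equiv.swap y z)).card < (badPairs w).card := by
  obtain ⟨⟨y, y'⟩, hyy⟩ := hbad
  simp only [badPairs, mem_filter, mem_univ, true_and] at hyy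
  obtain ⟨hne, hcol, hlet⟩ := hyy
  have hwm : ∀ i, ({x | w x = i} : Finset (V × Fin ℓ)).card = m :=
    mem_words.1 (mem_filter.1 hw).1
  have hℓ : 0 < ℓ := lt_of_le_of_lt (Nat.zero_le _) y.2.2
  -- The exchange partner z of y must avoid `F1`, the positions carrying a letter of the column of
  -- y, and `F2`, the columns containing the letter of y. Each has at most mℓ positions, while the
  -- side of y has more than 2mℓ.
  set F1 : Finset (V × Fin ℓ) :=
    (univ : Finset (Fin ℓ)).biUnion fun a => {x | w x = w (y.1, a)} with hF1
  set F2 : Finset (V × Fin ℓ) :=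
    (({x | w x = w y} : Finset (V × Fin ℓ)).image Prod.fst) ×ˢ univ with hF2
  have hF1c : F1.card ≤ ℓ * m := by
    refine card_biUnion_le.trans ?_
    simp [hwm]
  have hF2c : F2.card ≤ m * ℓ := by
    rw [hF2, card_product, card_univ, Fintype.card_fin]
    exact Nat.mul_le_mul_right _ (card_image_le.trans (hwm _).le)
  have hside : 2 * m * ℓ < (sameSide S y).card := by
    rw [card_sameSide]
    refine Nat.mul_lt_mul_of_pos_right ?_ hℓ
    split_ifs with h
    · exact hS.resolve_left (card_pos.2 ⟨_, h⟩).ne'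
    · exact hS'.resolve_left (card_pos.2 ⟨y.1, by simpa⟩).ne'
  obtain ⟨z, hz, hzF⟩ : ∃ z ∈ sameSide S y, z ∉ F1 ∪ F2 := by
    refine exists_mem_notMem_of_card_lt_card (lt_of_le_of_lt (card_union_le _ _) ?_)
    nlinarith
  simp only [hF1, hF2, mem_union, mem_biUnion, mem_univ, mem_filter, true_and, not_or, mem_product,
    mem_image, and_true, not_exists, not_and] at hzF
  obtain ⟨hz1, hz2⟩ := hzF
  simp only [sameSide, mem_filter, mem_univ, true_and] at hz
  have hzy : z.1 ≠ y.1 := fun h => hz2 y rfl h.symm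
  have hzny : z ≠ y := fun h => hzy (congrArg _ h)
  refine ⟨y, z, comp_swap_mem_evenWords hw hz, card_lt_card ⟨?_, fun hsub => ?_⟩⟩
  · rintro ⟨p, p'⟩ hp
    simp only [badPairs, mem_filter, mem_univ, true_and, Function.comp_apply] at hp ⊢
    -- After the exchange neither y nor z is in a bad pair, so no bad pair is created; the pair (y,
    -- y') is destroyed.
    have key : ∀ q q' : V × Fin ℓ, q ≠ q' → q.1 = q'.1 →
        w (Equiv.swap y z q) = w (Equiv.swap y z q') → q ≠ y ∧ q ≠ z := by
      intro q q' hq hqc hqw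
      constructor
      · rintro rfl
        have h1 : q' ≠ z := fun h => hzy (by rw [← h, hqc])
        rw [Equiv.swap_apply_left, Equiv.swap_apply_of_ne_of_ne hq.symm h1] at hqw
        refine hz1 q'.2 ?_
        rw [hqc]
        exact hqw
      · rintro rfl
        have h1 : q' ≠ y := fun h => hzy (by rw [← h, hqc])
        rw [Equiv.swap_apply_right, Equiv.swap_apply_of_ne_of_ne h1 hq.symm] at hqw
        exact hz2 q' hqw.symm hqc.symm
    obtain ⟨h1, h2⟩ := key p p' hp.1 hp.2.1 hp.2.2
    obtain ⟨h3, h4⟩ := key p' p hp.1.symm hp.2.1.symm hp.2.2.symm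
    rw [Equiv.swap_apply_of_ne_of_ne h1 h2, Equiv.swap_apply_of_ne_of_ne h3 h4] at hp
    exact hp
  · have h := @hsub (y, y') (by simp [badPairs, hne, hcol, hlet])
    simp only [badPairs, mem_filter, mem_univ, true_and, Function.comp_apply] at h
    have h1 : y' ≠ z := fun h => hzy (by rw [← h, hcol])
    rw [Equiv.swap_apply_left, Equiv.swap_apply_of_ne_of_ne hne.symm h1] at h
    refine hz1 y'.2 ?_
    rw [hcol]
    exact h.2.2

/-- Up to a polynomial factor, all words of `evenWords ℓ m r S` have no bad pair. -/
lemma card_evenWords_le [Nonempty V] {S : Finset V} (hℓ : 2 ≤ ℓ) (hS : S.card = 0 ∨ 2 * m < S.card)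
    (hS' : Sᶜ.card = 0 ∨ 2 * m < Sᶜ.card) :
    (evenWords ℓ m r S).card ≤ 2 * (Fintype.card V * ℓ) ^ (2 * (8 * ℓ * m)) *
      ((evenWords ℓ m r S).filter fun w => badPairs w = ∅).card := by
  set Ω := evenWords ℓ m r S with hΩ
  set M := Fintype.card V * ℓ with hM
  -- A word with at most j + 1 bad pairs is one exchange away from a word with at most j, and there
  -- are M² exchanges. A word that is already good uses the trivial exchange of a position with
  -- itself.
  have hstep : ∀ j, (Ω.filter fun w => (badPairs w).card ≤ j).card ≤
      (M ^ 2) ^ j * (Ω.filter fun w => badPairs w = ∅).card := by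
    intro j
    induction j with
    | zero => simp
    | succ j ih =>
      have hsub : (Ω.filter fun w => (badPairs w).card ≤ j + 1) ⊆
          ((univ : Finset ((V × Fin ℓ) × (V × Fin ℓ))) ×ˢ
            (Ω.filter fun w => (badPairs w).card ≤ j)).image
            fun x => x.2 ∘ Equiv.swap x.1.1 x.1.2 := by
        intro w hw
        rw [mem_filter] at hw
        rw [mem_image]
        by_cases h : (badPairs w).Nonempty
        · obtain ⟨y, z, h1, h2⟩ := exists_swap_card_badPairs_lt hS hS' hw.1 h
          refine ⟨((y, z), w ∘ Equiv.swap y z), ?_, by ext; simp⟩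
          simp only [mem_product, mem_univ, true_and, mem_filter]
          exact ⟨h1, by omega⟩
        · let y : V × Fin ℓ := (Classical.arbitrary V, ⟨0, by omega⟩)
          refine ⟨((y, y), w), ?_, by ext; simp⟩
          rw [not_nonempty_iff_eq_empty] at h
          simp [h, hw.1]
      calc _ ≤ _ := card_le_card hsub
        _ ≤ _ := card_image_le
        _ = M ^ 2 * (Ω.filter fun w => (badPairs w).card ≤ j).card := by
          rw [card_product]
          simp [hM, sq]
        _ ≤ M ^ 2 * ((M ^ 2) ^ j * (Ω.filter fun w => badPairs w = ∅).card) :=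
          Nat.mul_le_mul_left _ ih
        _ = _ := by ring
  -- Markov's inequality: the mean number of bad pairs is at most 4ℓm, so at least half of the words
  -- have at most 8ℓm.
  have hmarkov : Ω.card ≤ 2 * (Ω.filter fun w => (badPairs w).card ≤ 8 * ℓ * m).card := by
    have h1 := sum_card_badPairs_le (m := m) (r := r) (S := S) hℓ
    rw [← hΩ] at h1
    have h2 : (Ω.filter fun w => ¬ (badPairs w).card ≤ 8 * ℓ * m).card * (8 * ℓ * m + 1) ≤
        ∑ w ∈ Ω, (badPairs w).card := by
      refine le_trans ?_ (sum_le_sum_of_subset (filter_subset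
        (fun w => ¬ (badPairs w).card ≤ 8 * ℓ * m) Ω))
      rw [← smul_eq_mul, ← sum_const]
      refine sum_le_sum fun w hw => ?_
      have := (mem_filter.1 hw).2
      omega
    have h3 := card_filter_add_card_filter_not (s := Ω) (fun w => (badPairs w).card ≤ 8 * ℓ * m)
    by_contra! h4
    have h5 : Ω.card < 2 * (Ω.filter fun w => ¬ (badPairs w).card ≤ 8 * ℓ * m).card := by omega
    have h6 := Nat.mul_le_mul_left (4 * ℓ * m) h5.le
    nlinarith
  calc Ω.card ≤ _ := hmarkov
    _ ≤ 2 * ((M ^ 2) ^ (8 * ℓ * m) * (Ω.filter fun w => badPairs w = ∅).card) :=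
      Nat.mul_le_mul_left _ (hstep _)
    _ = _ := by rw [← pow_mul]; ring

end Switching

/-! ### From words to parity-check matrices and codewords -/

section Matrices

variable {ℓ m r n : ℕ}

/-- All rows of `H` have even weight on the set `S` of columns. -/
def ChecksOn {ι : Type*} (H : Matrix ι (Fin n) (ZMod 2)) (S : Finset (Fin n)) : Prop :=
  ∀ i, Even ({j ∈ S | H i j ≠ 0} : Finset (Fin n)).card

instance {ι : Type*} [Fintype ι] (H : Matrix ι (Fin n) (ZMod 2)) (S : Finset (Fin n)) :
    Decidable (ChecksOn H S) := by
  unfold ChecksOn; infer_instance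

/-- The matrix whose columns have as supports the letters of the columns of `w`. -/
def wordMatrix (w : Fin n × Fin ℓ → Fin r) : Matrix (Fin r) (Fin n) (ZMod 2) :=
  fun i j => if ∃ a, w (j, a) = i then 1 else 0

lemma wordMatrix_ne_zero {w : Fin n × Fin ℓ → Fin r} {i : Fin r} {j : Fin n} :
    wordMatrix w i j ≠ 0 ↔ ∃ a, w (j, a) = i := by
  simp [wordMatrix]

lemma badPairs_eq_empty {w : Fin n × Fin ℓ → Fin r} :
    badPairs w = ∅ ↔ ∀ j, Function.Injective fun a => w (j, a) := by
  simp only [badPairs, filter_eq_empty_iff, mem_univ, true_imp_iff]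
  constructor
  · intro h j a b hab
    by_contra hne
    exact @h ((j, a), (j, b)) ⟨by simpa using hne, rfl, hab⟩
  · rintro h ⟨⟨j, a⟩, ⟨j', b⟩⟩ ⟨h1, h2, h3⟩
    obtain rfl : j = j' := h2
    exact h1 (by rw [h j h3])

/-- Without bad pairs a letter occurs at most once per column, so projection to the column is
injective on its positions and parities agree. -/
lemma card_filter_letter_eq {w : Fin n × Fin ℓ → Fin r} (hw : badPairs w = ∅)
    (S : Finset (Fin n)) (i : Fin r) :
    ({y ∈ S ×ˢ univ | w y = i} : Finset (Fin n × Fin ℓ)).card =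
      ({j ∈ S | wordMatrix w i j ≠ 0} : Finset (Fin n)).card := by
  rw [badPairs_eq_empty] at hw
  refine card_bij (fun y _ => y.1) ?_ ?_ ?_
  · rintro ⟨j, a⟩ hy
    simp only [mem_filter, mem_product, mem_univ, and_true] at hy
    rw [mem_filter, wordMatrix_ne_zero]
    exact ⟨hy.1, a, hy.2⟩
  · rintro ⟨j, a⟩ hy ⟨j', b⟩ hy' h
    obtain rfl : j = j' := h
    simp only [mem_filter] at hy hy'
    rw [hw j (hy.2.trans hy'.2.symm)]
  · intro j hj
    rw [mem_filter, wordMatrix_ne_zero] at hj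
    obtain ⟨hj, a, ha⟩ := hj
    exact ⟨(j, a), by simp [hj, ha], rfl⟩

lemma card_injective_range_eq {R : Type*} [Fintype R] [DecidableEq R] {T : Finset R}
    (hT : T.card = ℓ) :
    (univ.filter fun f : Fin ℓ → R => Function.Injective f ∧ ∀ i, (∃ a, f a = i) ↔ i ∈ T).card =
      ℓ.factorial := by
  have e : Fin ℓ ≃ T := Fintype.equivOfCardEq (by simp [hT])
  rw [← Fintype.card_subtype]
  have h := Fintype.card_equiv e
  rw [Fintype.card_fin] at h
  rw [← h]
  refine Fintype.card_congr ⟨fun f => Equiv.ofBijective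
    (fun a => ⟨f.1 a, (f.2.2 _).1 ⟨a, rfl⟩⟩) ⟨?_, ?_⟩, fun g => ⟨fun a => g a, ?_, ?_⟩, ?_, ?_⟩
  · intro a b hab
    exact f.2.1 (congrArg Subtype.val hab)
  · rintro ⟨i, hi⟩
    obtain ⟨a, ha⟩ := (f.2.2 i).2 hi
    exact ⟨a, Subtype.ext ha⟩
  · exact Subtype.val_injective.comp g.injective
  · intro i
    constructor
    · rintro ⟨a, rfl⟩
      exact (g a).2
    · intro hi
      exact ⟨g.symm ⟨i, hi⟩, by simp⟩
  · intro f
    rfl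
  · intro g
    ext
    rfl

/-- A preimage is an ordering of the support of each column, chosen independently. The multiplicity
is the same for all matrices, so uniform words give uniform matrices. -/
lemma card_wordMatrix_fiber {H : Matrix (Fin r) (Fin n) (ZMod 2)}
    (hH : ∀ j, hammingNorm (fun i => H i j) = ℓ) :
    (univ.filter fun w : Fin n × Fin ℓ → Fin r => badPairs w = ∅ ∧ wordMatrix w = H).card =
      ℓ.factorial ^ n := by
  have hT : ∀ j, ({i | H i j ≠ 0} : Finset (Fin r)).card = ℓ := hH
  have : ℓ.factorial ^ n = (Fintype.piFinset fun j : Fin n =>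
      (univ.filter fun f : Fin ℓ → Fin r =>
        Function.Injective f ∧ ∀ i, (∃ a, f a = i) ↔ i ∈ ({i | H i j ≠ 0} : Finset (Fin r)))).card := by
    rw [Fintype.card_piFinset]
    have hn : ℓ.factorial ^ n = ∏ _j : Fin n, ℓ.factorial := by simp
    rw [hn]
    refine prod_congr rfl fun j _ => ?_
    convert (card_injective_range_eq (hT j)).symm
  rw [this]
  refine card_bij' (fun w _ j a => w (j, a)) (fun f _ y => f y.1 y.2) ?_ ?_ ?_ ?_
  · intro w hw
    simp only [mem_filter, mem_univ, true_and, badPairs_eq_empty] at hw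
    simp only [Fintype.mem_piFinset, mem_filter, mem_univ, true_and]
    refine fun j => ⟨hw.1 j, fun i => ?_⟩
    rw [← hw.2, wordMatrix_ne_zero]
  · intro f hf
    simp only [Fintype.mem_piFinset, mem_filter, mem_univ, true_and] at hf
    simp only [mem_filter, mem_univ, true_and, badPairs_eq_empty]
    refine ⟨fun j => (hf j).1, ?_⟩
    ext i j
    simp only [wordMatrix]
    rw [if_congr ((hf j).2 i) rfl rfl]
    split_ifs with h
    · have h2 : ∀ x : ZMod 2, x ≠ 0 → 1 = x := by decide
      rw [h2 _ h]
    · rw [not_not.1 h]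
  · intro w _
    rfl
  · intro f _
    rfl

/-- Every matrix of the ensemble that checks `S` comes from `ℓ! ^ n` words. -/
lemma card_simple_evenWords (S : Finset (Fin n)) :
    ((evenWords ℓ m r S).filter fun w => badPairs w = ∅).card =
      ((matricesA ℓ m r n).filter fun H => ChecksOn H S).card * ℓ.factorial ^ n := by
  rw [card_eq_sum_card_fiberwise (f := wordMatrix)
    (t := (matricesA ℓ m r n).filter fun H => ChecksOn H S)]
  · rw [← smul_eq_mul, ← sum_const]
    refine sum_congr rfl fun H hH => ?_
    simp only [matricesA, mem_filter, mem_univ, true_and] at hH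
    rw [← card_wordMatrix_fiber hH.1.2]
    congr 1
    ext w
    simp only [mem_filter, mem_univ, true_and, and_congr_left_iff, and_iff_right_iff_imp]
    rintro rfl hw
    rw [evenWords, mem_filter, mem_words]
    refine ⟨fun i => ?_, fun i => ?_⟩
    · have := card_filter_letter_eq hw univ i
      rw [univ_product_univ] at this
      rw [this]
      exact hH.1.1 i
    · rw [card_filter_letter_eq hw]
      exact hH.2 i
  · intro w hw
    simp only [evenWords, coe_filter, Set.mem_ofPred_eq, mem_filter, mem_words] at hw
    simp only [matricesA, coe_filter, Set.mem_ofPred_eq, mem_filter, mem_univ, true_and]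
    refine ⟨⟨fun i => ?_, fun j => ?_⟩, fun i => ?_⟩
    · have := card_filter_letter_eq hw.2 univ i
      rw [univ_product_univ] at this
      rw [← hw.1.1 i, this]
      rfl
    · have hinj := badPairs_eq_empty.1 hw.2 j
      have : ({i | wordMatrix w i j ≠ 0} : Finset (Fin r)) = univ.image fun a => w (j, a) := by
        ext i
        simp [wordMatrix_ne_zero]
      change ({i | wordMatrix w i j ≠ 0} : Finset (Fin r)).card = ℓ
      rw [this, card_image_of_injective _ hinj, card_univ, Fintype.card_fin]
    · rw [← card_filter_letter_eq hw.2]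
      exact hw.1.2 i

lemma indicator_mem_code {ι : Type*} (H : Matrix ι (Fin n) (ZMod 2)) (S : Finset (Fin n)) :
    (fun j => if j ∈ S then (1 : ZMod 2) else 0) ∈ code H ↔ ChecksOn H S := by
  rw [code, LinearMap.mem_ker, Matrix.mulVecLin_apply, funext_iff]
  refine forall_congr' fun i => ?_
  rw [← ZMod.natCast_eq_zero_iff_even]
  have h : ∀ x : ZMod 2, x ≠ 0 → x = 1 := by decide
  have : (∑ j, H i j * if j ∈ S then (1 : ZMod 2) else 0) =
      (({j ∈ S | H i j ≠ 0} : Finset (Fin n)).card : ZMod 2) := by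
    simp only [mul_ite, mul_one, mul_zero]
    rw [← sum_filter, filter_mem_eq_inter, univ_inter, card_filter, Nat.cast_sum]
    refine sum_congr rfl fun j _ => ?_
    by_cases h0 : H i j = 0
    · simp [h0]
    · simp [h _ h0]
  rw [← this]
  rfl

/-- The null-free size of a shortened code counts the nonempty sets of positions in `J` on which
all checks hold. -/
lemma nullFreeSize_shortened {ι : Type*} [Fintype ι] (H : Matrix ι (Fin n) (ZMod 2))
    (J : Finset (Fin n)) :
    nullFreeSize (shortened (code H) J) =
      ((J.powerset.erase ∅).filter fun S => ChecksOn H S).card := by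
  have h2 : ∀ x : ZMod 2, x ≠ 0 → x = 1 := by decide
  -- A binary word vanishing outside J is the indicator of the support of its restriction to J.
  have hext : ∀ u : J → ZMod 2, ∀ c : Fin n → ZMod 2, (∀ i, i ∉ J → c i = 0) →
      (∀ i : J, u i = c i) → c = fun j => if j ∈ (univ.filter fun i : J => u i ≠ 0).map
        (Function.Embedding.subtype _) then (1 : ZMod 2) else 0 := by
    intro u c h0 h1
    funext j
    by_cases hj : j ∈ J
    · simp only [Finset.mem_map, mem_filter, mem_univ, true_and, Function.Embedding.subtype_apply,
        Subtype.exists, exists_and_right, exists_eq_right]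
      by_cases hc : c j = 0
      · rw [hc, if_neg]
        rintro ⟨_, h⟩
        exact h (by rw [h1, hc])
      · rw [h2 _ hc, if_pos ⟨hj, by rwa [h1]⟩]
    · rw [h0 j hj, if_neg]
      simp only [Finset.mem_map, Function.Embedding.subtype_apply, Subtype.exists]
      rintro ⟨a, ha, _, rfl⟩
      exact hj ha
  rw [nullFreeSize, ← Set.ncard_coe_finset]
  refine Set.ncard_congr (fun u _ => (univ.filter fun i : J => u i ≠ 0).map
        (Function.Embedding.subtype _)) ?_ ?_ ?_
  · rintro u ⟨⟨c, hc, h0, h1⟩, hu⟩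
    simp only [coe_filter, mem_erase, mem_powerset, Set.mem_ofPred_eq]
    refine ⟨⟨?_, ?_⟩, ?_⟩
    · obtain ⟨i, hi⟩ := Function.ne_iff.1 hu
      refine Nonempty.ne_empty ⟨i, Finset.mem_map.2 ⟨i, by simpa using hi, rfl⟩⟩
    · intro j hj
      obtain ⟨i, _, rfl⟩   := Finset.mem_map.1 hj
      exact i.2
    · rw [← indicator_mem_code, ← hext u c h0 h1]
      exact hc
  · rintro u v _ _ h
    have h' := map_injective _ h
    funext i
    have hi := congrArg (fun T : Finset J => i ∈ T) h'
    simp only [mem_filter, mem_univ, true_and, eq_iff_iff] at hi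
    by_cases hu : u i = 0
    · rw [hu]
      by_contra hv
      exact hi.2 (Ne.symm hv) hu
    · rw [h2 _ hu, h2 _ (hi.1 hu)]
  · intro S hS
    simp only [coe_filter, mem_erase, mem_powerset, Set.mem_ofPred_eq] at hS
    obtain ⟨⟨hne, hSJ⟩, hch⟩ := hS
    have key : (univ.filter fun i : J => (if (i : Fin n) ∈ S then (1 : ZMod 2) else 0) ≠ 0).map
        (Function.Embedding.subtype _) = S := by
      ext j
      simp only [Finset.mem_map, mem_filter, mem_univ, true_and, Function.Embedding.subtype_apply,
        Subtype.exists, exists_and_right, exists_eq_right]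
      constructor
      · rintro ⟨_, h⟩
        by_contra hj
        simp [hj] at h
      · intro h
        exact ⟨hSJ h, by simp [h]⟩
    refine ⟨fun i => if (i : Fin n) ∈ S then 1 else 0, ⟨⟨_, (indicator_mem_code H S).2 hch,
      fun i hi => if_neg fun h => hi (hSJ h), fun i => rfl⟩, ?_⟩, key⟩
    obtain ⟨j, hj⟩ := nonempty_iff_ne_empty.2 hne
    intro h
    have := congrFun h ⟨j, hSJ hj⟩
    simp [hj] at this

end Matrices

/-! ### Probability that a set of positions satisfies all checks -/

section Averages

variable {ℓ m r n s : ℕ}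

lemma snd_mem_words : (Prod.snd : Fin m × Fin r → Fin r) ∈ words (Fin m × Fin r) (Fin r) m := by
  rw [mem_words]
  intro i
  have : ({y | y.2 = i} : Finset (Fin m × Fin r)) = univ ×ˢ {i} := by
    ext ⟨a, b⟩
    simp [eq_comm]
  rw [this, card_product]
  simp

lemma comp_equiv_mem_words {Y Z R : Type*} [Fintype Y] [DecidableEq Y] [Fintype Z] [DecidableEq Z]
    [Fintype R] [DecidableEq R] {w : Y → R} (hw : w ∈ words Y R m) (τ : Z ≃ Y) :
    w ∘ τ ∈ words Z R m := by
  rw [mem_words] at hw ⊢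
  intro i
  rw [← hw i]
  exact card_bij' (fun y _ => τ y) (fun y _ => τ.symm y) (by simp) (by simp) (by simp) (by simp)

lemma modNat_mem_words (π : Equiv.Perm (Fin (m * s))) :
    (fun j => (π j).modNat) ∈ words (Fin (m * s)) (Fin s) m :=
  comp_equiv_mem_words snd_mem_words (π.trans finProdFinEquiv.symm)

lemma checksOn_gallagerMatrix (π : Fin ℓ → Equiv.Perm (Fin (m * s))) (S : Finset (Fin (m * s))) :
    ChecksOn (gallagerMatrix ℓ m s π) S ↔ ∀ i, IsEvenOn (fun j => (π i j).modNat) S := by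
  have : ∀ (i : Fin ℓ) (a : Fin s) (j : Fin (m * s)),
      gallagerMatrix ℓ m s π (i, a) j ≠ 0 ↔ (π i j).modNat = a := by
    intro i a j
    simp [gallagerMatrix, unitBlock, Fin.ext_iff]
  constructor
  · intro h i a
    have := h (i, a)
    simpa only [‹∀ (i : Fin ℓ) (a : Fin s) (j : Fin (m * s)), _›] using this
  · rintro h ⟨i, a⟩
    have := h i a
    simpa only [‹∀ (i : Fin ℓ) (a : Fin s) (j : Fin (m * s)), _›] using this

/-- The average null-free size for the Gallager ensemble. -/
lemma avgSizeB_eq (J : Finset (Fin (m * s))) :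
    avgSizeB ℓ m s J = ∑ S ∈ J.powerset.erase ∅,
      ((evenWt m s S.card : ℝ) / ((m * s).choose S.card)) ^ ℓ := by
  have hprob : ∀ S : Finset (Fin (m * s)),
      ((univ.filter fun π : Fin ℓ → Equiv.Perm (Fin (m * s)) =>
        ChecksOn (gallagerMatrix ℓ m s π) S).card : ℝ) /
        (Fintype.card (Fin ℓ → Equiv.Perm (Fin (m * s))) : ℝ) =
      ((evenWt m s S.card : ℝ) / ((m * s).choose S.card)) ^ ℓ := by
    intro S
    -- Independence of the blocks: the event is a product, so the ℓ-th power appears. Invariance of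
    -- each factor comes from right multiplication of permutations.
    have h1 : (univ.filter fun π : Fin ℓ → Equiv.Perm (Fin (m * s)) =>
        ChecksOn (gallagerMatrix ℓ m s π) S) = Fintype.piFinset fun _ : Fin ℓ =>
          (univ.filter fun π : Equiv.Perm (Fin (m * s)) =>
            IsEvenOn (fun j => (π j).modNat) S) := by
      ext π
      simp [checksOn_gallagerMatrix]
    have h2 := card_even_mul_choose (m := m) (univ : Finset (Equiv.Perm (Fin (m * s))))
      (fun π j => (π j).modNat) (fun π _ => modNat_mem_words π)
      (fun τ => ⟨Equiv.mulRight τ, fun π => ⟨by simp, rfl⟩⟩) S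
    rw [h1, Fintype.card_piFinset_const, Fintype.card_fun, Fintype.card_fin, Nat.cast_pow,
      Nat.cast_pow, ← div_pow]
    congr 1
    have hc : ((m * s).choose S.card : ℝ) ≠ 0 := by
      exact_mod_cast (Nat.choose_pos (by simpa using card_le_univ S)).ne'
    rw [Fintype.card_fin, card_univ] at h2
    rw [div_eq_div_iff (by positivity) hc]
    rw [mul_comm (evenWt _ _ _ : ℝ)]
    exact_mod_cast h2
  rw [avgSizeB]
  simp_rw [nullFreeSize_shortened]
  simp_rw [← hprob]
  rw [← sum_div]
  congr 1
  have := sum_card_bipartiteAbove_eq_sum_card_bipartiteBelow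
    (s := (univ : Finset (Fin ℓ → Equiv.Perm (Fin (m * s))))) (t := J.powerset.erase ∅)
    (r := fun π S => ChecksOn (gallagerMatrix ℓ m s π) S)
  exact_mod_cast this

/-- The proportion of matrices of `𝔸(ℓ, m)` all of whose rows have even weight on `S`. -/
noncomputable def probA (ℓ m r n : ℕ) (S : Finset (Fin n)) : ℝ :=
  (((matricesA ℓ m r n).filter fun H => ChecksOn H S).card : ℝ) / (matricesA ℓ m r n).card

lemma avgSizeA_eq (J : Finset (Fin n)) :
    avgSizeA ℓ m r n J = ∑ S ∈ J.powerset.erase ∅, probA ℓ m r n S := by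
  rw [avgSizeA]
  simp_rw [nullFreeSize_shortened, probA]
  rw [← sum_div]
  congr 1
  have := sum_card_bipartiteAbove_eq_sum_card_bipartiteBelow
    (s := matricesA ℓ m r n) (t := J.powerset.erase ∅) (r := fun H S => ChecksOn H S)
  exact_mod_cast this

lemma card_evenWords_mul_choose (S : Finset (Fin n)) :
    (evenWords ℓ m r S).card * (ℓ * n).choose (ℓ * S.card) =
      (words (Fin n × Fin ℓ) (Fin r) m).card * evenWt m r (ℓ * S.card) := by
  have h := card_even_mul_choose (m := m) (words (Fin n × Fin ℓ) (Fin r) m) id (fun _ h => h)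
    (fun τ => ⟨Equiv.arrowCongr τ.symm (Equiv.refl _), fun w => ⟨⟨fun h => ?_, fun h => ?_⟩, rfl⟩⟩)
    (S ×ˢ univ)
  · simpa [mul_comm, evenWords] using h
  · have := comp_perm_mem_words h τ.symm
    convert this using 1
    ext y
    simp
  · exact comp_perm_mem_words h τ

lemma card_words_pos (h : m * r = ℓ * n) : 0 < (words (Fin n × Fin ℓ) (Fin r) m).card := by
  have e : Fin n × Fin ℓ ≃ Fin m × Fin r := Fintype.equivOfCardEq (by simp [h, mul_comm])
  exact card_pos.2 ⟨_, comp_equiv_mem_words snd_mem_words e⟩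

lemma evenWords_empty : evenWords ℓ m r (∅ : Finset (Fin n)) = words (Fin n × Fin ℓ) (Fin r) m := by
  simp [evenWords, IsEvenOn]

/-- The multiplicity ℓ!^n cancels, and the empty set imposes no check, so it supplies the
denominator. -/
lemma probA_eq (S : Finset (Fin n)) :
    probA ℓ m r n S = (((evenWords ℓ m r S).filter fun w => badPairs w = ∅).card : ℝ) /
      ((evenWords ℓ m r (∅ : Finset (Fin n))).filter fun w => badPairs w = ∅).card := by
  have h0 : ((matricesA ℓ m r n).filter fun H => ChecksOn H ∅) = matricesA ℓ m r n := by
    simp [ChecksOn]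
  rw [card_simple_evenWords, card_simple_evenWords, h0, probA]
  push_cast
  rw [mul_div_mul_right]
  positivity

/-- The polynomial factor lost when bad pairs are removed. -/
noncomputable def polyFactor (ℓ m n : ℕ) : ℝ := 2 * ((n * ℓ : ℕ) : ℝ) ^ (2 * (8 * ℓ * m))

lemma card_words_le (hℓ : 2 ≤ ℓ) (hn : 2 * m < n) :
    ((words (Fin n × Fin ℓ) (Fin r) m).card : ℝ) ≤ polyFactor ℓ m n *
      ((evenWords ℓ m r (∅ : Finset (Fin n))).filter fun w => badPairs w = ∅).card := by
  have : Nonempty (Fin n) := ⟨⟨0, by omega⟩⟩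
  have h := card_evenWords_le (V := Fin n) (m := m) (r := r) (S := ∅) hℓ (by simp)
    (by right; simpa using hn)
  rw [evenWords_empty, Fintype.card_fin] at h
  rw [polyFactor, evenWords_empty]
  exact_mod_cast h

lemma even_ratio (S : Finset (Fin n)) (h : m * r = ℓ * n) :
    (evenWt m r (ℓ * S.card) : ℝ) / (m * r).choose (ℓ * S.card) =
      ((evenWords ℓ m r S).card : ℝ) / (words (Fin n × Fin ℓ) (Fin r) m).card := by
  have h1 := card_evenWords_mul_choose (m := m) (r := r) (ℓ := ℓ) S
  rw [← h] at h1
  have hS : ℓ * S.card ≤ m * r := by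
    rw [h]
    exact Nat.mul_le_mul_left _ (by simpa using card_le_univ S)
  have hw := card_words_pos h
  rw [div_eq_div_iff (by exact_mod_cast (Nat.choose_pos hS).ne') (by exact_mod_cast hw.ne')]
  rw [mul_comm]
  exact_mod_cast h1.symm

/-- Only the denominator needs switching, and there the set is empty; hence no restriction on the
size of S. Positivity of the number of good words is part of the argument. -/
lemma probA_le (hℓ : 2 ≤ ℓ) (hn : 2 * m < n) (h : m * r = ℓ * n) (S : Finset (Fin n)) :
    probA ℓ m r n S ≤ polyFactor ℓ m n *
      ((evenWt m r (ℓ * S.card) : ℝ) / (m * r).choose (ℓ * S.card)) := by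
  have hw : (0 : ℝ) < (words (Fin n × Fin ℓ) (Fin r) m).card := by exact_mod_cast card_words_pos h
  have hD := card_words_le (r := r) hℓ hn
  rw [even_ratio S h, probA_eq]
  set s0 : ℝ := (((evenWords ℓ m r (∅ : Finset (Fin n))).filter fun w => badPairs w = ∅).card : ℝ)
  have hs0 : 0 < s0 := by
    by_contra! h0
    rw [le_antisymm h0 (Nat.cast_nonneg _), mul_zero] at hD
    linarith
  have h1 : (((evenWords ℓ m r S).filter fun w => badPairs w = ∅).card : ℝ) ≤
      (evenWords ℓ m r S).card := by exact_mod_cast card_filter_le _ _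
  rw [← mul_div_assoc, div_le_div_iff₀ hs0 hw]
  calc _ ≤ ((evenWords ℓ m r S).card : ℝ) * (polyFactor ℓ m n * s0) :=
        mul_le_mul h1 hD hw.le (Nat.cast_nonneg _)
    _ = _ := by ring

/-- Here the numerator loses the polynomial factor, so switching must work inside S and inside its
complement: both need more than 2m columns. -/
lemma le_probA (hℓ : 2 ≤ ℓ) (hn : 2 * m < n) (h : m * r = ℓ * n) (S : Finset (Fin n))
    (hS : 2 * m < S.card) (hS' : 2 * m + S.card < n) :
    (polyFactor ℓ m n)⁻¹ * ((evenWt m r (ℓ * S.card) : ℝ) / (m * r).choose (ℓ * S.card)) ≤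
      probA ℓ m r n S := by
  have : Nonempty (Fin n) := ⟨⟨0, by omega⟩⟩
  have hw : (0 : ℝ) < (words (Fin n × Fin ℓ) (Fin r) m).card := by exact_mod_cast card_words_pos h
  have hD := card_words_le (r := r) hℓ hn
  have hP : 0 < polyFactor ℓ m n := by
    have : 0 < n * ℓ := Nat.mul_pos (by omega) (by omega)
    unfold polyFactor
    positivity
  rw [even_ratio S h, probA_eq]
  set s0 : ℝ := (((evenWords ℓ m r (∅ : Finset (Fin n))).filter fun w => badPairs w = ∅).card : ℝ)
    with hs0d
  have hs0 : 0 < s0 := by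
    by_contra! h0
    rw [le_antisymm h0 (Nat.cast_nonneg _), mul_zero] at hD
    linarith
  have h2 : s0 ≤ (words (Fin n × Fin ℓ) (Fin r) m).card := by
    rw [hs0d, evenWords_empty]
    exact_mod_cast card_filter_le _ _
  have h1 : ((evenWords ℓ m r S).card : ℝ) ≤ polyFactor ℓ m n *
      ((evenWords ℓ m r S).filter fun w => badPairs w = ∅).card := by
    have h := card_evenWords_le (V := Fin n) (m := m) (r := r) (S := S) hℓ (Or.inr hS)
      (Or.inr (by rw [card_compl, Fintype.card_fin]; omega))
    rw [Fintype.card_fin] at h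
    rw [polyFactor]
    exact_mod_cast h
  rw [inv_mul_le_iff₀ hP, ← mul_div_assoc]
  exact div_le_div₀ (by positivity) h1 hs0 h2

end Averages

/-! ### The even-weight generating function and its saddle point -/

section Generating

variable {m : ℕ}

/-- The even numbers `≤ m`. -/
def evens (m : ℕ) : Finset ℕ := (range (m + 1)).filter Even

/-- The generating function of the even-weight vectors of length `m`. -/
noncomputable def gen (m : ℕ) (t : ℝ) : ℝ := ((1 + t) ^ m + (1 - t) ^ m) / 2

/-- The generating function of the even-weight vectors of length `m`, weighted by their weight. -/
noncomputable def genMean (m : ℕ) (t : ℝ) : ℝ := ∑ i ∈ evens m, (i : ℝ) * (m.choose i * t ^ i)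

lemma gen_eq_sum (m : ℕ) (t : ℝ) : gen m t = ∑ i ∈ evens m, (m.choose i : ℝ) * t ^ i := by
  rw [gen, add_comm 1 t, show 1 - t = -t + 1 by ring, add_pow, add_pow, ← sum_add_distrib, sum_div,
    evens, sum_filter]
  refine sum_congr rfl fun i _ => ?_
  split_ifs with h
  · rw [h.neg_pow]; ring
  · rw [(Nat.not_even_iff_odd.1 h).neg_pow]; ring

lemma one_le_gen (m : ℕ) {t : ℝ} (ht : 0 ≤ t) : 1 ≤ gen m t := by
  rw [gen_eq_sum]
  have h0 : 0 ∈ evens m := by simp [evens]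
  refine le_trans ?_ (single_le_sum (f := fun i => (m.choose i : ℝ) * t ^ i)
    (fun i _ => by positivity) h0)
  simp

lemma gen_pos (m : ℕ) {t : ℝ} (ht : 0 ≤ t) : 0 < gen m t := zero_lt_one.trans_le (one_le_gen m ht)

lemma gen_pred (hm : 1 ≤ m) (t : ℝ) : m * gen (m - 1) t = m * gen m t - genMean m t := by
  obtain ⟨p, rfl⟩ : ∃ p, m = p + 1 := ⟨m - 1, by omega⟩
  rw [Nat.add_sub_cancel]
  have h1 : gen p t = ∑ i ∈ evens (p + 1), (p.choose i : ℝ) * t ^ i := by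
    rw [gen_eq_sum]
    refine sum_subset (fun i hi => ?_) fun i hi hi' => ?_
    · simp only [evens, mem_filter, mem_range] at hi ⊢
      exact ⟨by omega, hi.2⟩
    · simp only [evens, mem_filter, mem_range, not_and] at hi hi'
      have : p < i := by
        by_contra h
        exact hi' (by omega) hi.2
      simp [Nat.choose_eq_zero_of_lt this]
  rw [h1, gen_eq_sum, genMean, mul_sum, mul_sum, ← sum_sub_distrib]
  refine sum_congr rfl fun i hi => ?_
  have hi' : i ≤ p + 1 := by
    simp only [evens, mem_filter, mem_range] at hi
    omega
  have h2 := Nat.choose_mul_succ_eq p i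
  have h3 : (p.choose i : ℝ) * (p + 1) = (p + 1).choose i * ((p + 1) - i) := by
    have := congrArg (Nat.cast (R := ℝ)) h2
    rw [Nat.cast_mul, Nat.cast_mul, Nat.cast_sub hi'] at this
    push_cast at this
    exact this
  push_cast
  linear_combination t ^ i * h3

/-- Through m C(m-1, i) = (m-i) C(m, i), the equation says that the law on even weights proportional
to C(m, i) tⁱ has mean βm. Equivalently, t is a critical point of log `gen m t` - βm log t. -/
lemma isPosRoot_iff (hm : 1 ≤ m) {β t : ℝ} :
    IsPosRoot m β t ↔ 0 < t ∧ genMean m t = β * m * gen m t := by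
  rw [IsPosRoot]
  refine and_congr_right fun ht => ?_
  have hg := gen_pos m ht.le
  have h1 : ((1 + t) ^ (m - 1) + (1 - t) ^ (m - 1)) / ((1 + t) ^ m + (1 - t) ^ m) =
      gen (m - 1) t / gen m t := by
    rw [gen, gen, div_div_div_cancel_right₀ two_ne_zero]
  have hm' : (m : ℝ) ≠ 0 := by positivity
  rw [h1, div_eq_iff hg.ne', ← mul_right_inj' hm', gen_pred hm]
  constructor <;> intro h <;> linarith

/-- The mean weight `genMean` / `gen` increases strictly. Symmetrizing the double sum in i and j
gives terms (i-j)(uⁱtʲ - tⁱuʲ) ≥ 0, and the term i = 2, j = 0 is positive. -/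
lemma genMean_mul_gen_lt (hm : 2 ≤ m) {t u : ℝ} (ht : 0 < t) (htu : t < u) :
    genMean m t * gen m u < genMean m u * gen m t := by
  have hu := ht.trans htu
  set F : ℕ → ℕ → ℝ := fun i j => m.choose i * m.choose j * (u ^ i * t ^ j - t ^ i * u ^ j) with hF
  have h1 : genMean m u * gen m t - genMean m t * gen m u =
      ∑ i ∈ evens m, ∑ j ∈ evens m, i * F i j := by
    rw [gen_eq_sum, gen_eq_sum, genMean, genMean, sum_mul_sum, sum_mul_sum, ← sum_sub_distrib]
    refine sum_congr rfl fun i _ => ?_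
    rw [← sum_sub_distrib]
    exact sum_congr rfl fun j _ => by simp only [hF]; ring
  have h2 : ∑ i ∈ evens m, ∑ j ∈ evens m, (i : ℝ) * F i j =
      ∑ i ∈ evens m, ∑ j ∈ evens m, -((j : ℝ) * F i j) := by
    rw [sum_comm]
    exact sum_congr rfl fun i _ => sum_congr rfl fun j _ => by simp only [hF]; ring
  have hnn : ∀ i j : ℕ, 0 ≤ ((i : ℝ) - j) * F i j := by
    intro i j
    simp only [hF]
    rcases le_total i j with h | h
    · obtain ⟨d, rfl⟩ := Nat.exists_eq_add_of_le h
      have : t ^ d ≤ u ^ d := pow_le_pow_left₀ ht.le htu.le d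
      have h3 : ((i : ℝ) - (i + d : ℕ)) * (m.choose i * m.choose (i + d) *
          (u ^ i * t ^ (i + d) - t ^ i * u ^ (i + d))) =
          d * (m.choose i * m.choose (i + d)) * (u ^ i * t ^ i) * (u ^ d - t ^ d) := by
        push_cast; ring
      rw [h3]
      exact mul_nonneg (by positivity) (sub_nonneg.2 this)
    · obtain ⟨d, rfl⟩ := Nat.exists_eq_add_of_le h
      have : t ^ d ≤ u ^ d := pow_le_pow_left₀ ht.le htu.le d
      have h3 : (((j + d : ℕ) : ℝ) - j) * (m.choose (j + d) * m.choose j *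
          (u ^ (j + d) * t ^ j - t ^ (j + d) * u ^ j)) =
          d * (m.choose j * m.choose (j + d)) * (u ^ j * t ^ j) * (u ^ d - t ^ d) := by
        push_cast; ring
      rw [h3]
      exact mul_nonneg (by positivity) (sub_nonneg.2 this)
  have hpos : 0 < ∑ i ∈ evens m, ∑ j ∈ evens m, ((i : ℝ) - j) * F i j := by
    have e0 : 0 ∈ evens m := by simp [evens]
    have e2 : 2 ∈ evens m := by simp [evens]; omega
    refine sum_pos' (fun i _ => sum_nonneg fun j _ => hnn i j) ⟨2, e2, ?_⟩
    refine sum_pos' (fun j _ => hnn 2 j) ⟨0, e0, ?_⟩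
    have hc : (0 : ℝ) < m.choose 2 := by exact_mod_cast Nat.choose_pos hm
    have : t ^ 2 < u ^ 2 := pow_lt_pow_left₀ htu ht.le (by norm_num)
    simp only [hF]
    norm_num
    exact mul_pos hc (by linarith)
  have h3 : ∑ i ∈ evens m, ∑ j ∈ evens m, ((i : ℝ) - j) * F i j =
      2 * ∑ i ∈ evens m, ∑ j ∈ evens m, (i : ℝ) * F i j := by
    rw [two_mul]
    nth_rw 2 [h2]
    rw [← sum_add_distrib]
    refine sum_congr rfl fun i _ => ?_
    rw [← sum_add_distrib]
    exact sum_congr rfl fun j _ => by ring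
  linarith

lemma continuous_gen (m : ℕ) : Continuous (gen m) := by
  unfold gen; fun_prop

lemma continuous_genMean (m : ℕ) : Continuous (genMean m) := by
  unfold genMean; fun_prop

/-- For large `t` the mean weight comes close to the largest even number `≤ m`. -/
lemma exists_lt_genMean {y : ℝ} (hy : y < (2 * (m / 2) : ℕ)) :
    ∃ t : ℝ, 1 ≤ t ∧ y * gen m t < genMean m t := by
  set M := 2 * (m / 2) with hM
  have hMe : M ∈ evens m := by simp [evens, hM]; omega
  have hlt : ∀ i ∈ (evens m).erase M, i + 1 ≤ M := by
    intro i hi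
    simp only [evens, mem_erase, mem_filter, mem_range, Nat.even_iff] at hi
    omega
  set B : ℝ := ∑ i ∈ (evens m).erase M, (m.choose i : ℝ) * |y - i| with hB
  have hB0 : 0 ≤ B := sum_nonneg fun i _ => by positivity
  set c : ℝ := (m.choose M : ℝ) with hc
  have hc0 : 0 < c := by
    have : 0 < m.choose M := Nat.choose_pos (by omega)
    exact Nat.cast_pos.2 this
  set d : ℝ := M - y with hd
  have hd0 : 0 < d := by simp only [hd]; linarith
  -- The top weight M contributes c d t^M to the difference, and the others at least -B t^(M-1);
  -- this t makes t c d > B.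
  set t : ℝ := 1 + B / (c * d) with ht
  have ht1 : 1 ≤ t := by
    rw [ht]; have : 0 ≤ B / (c * d) := by positivity
    linarith
  have htB : B < t * (c * d) := by
    rw [ht, add_mul, div_mul_cancel₀ _ (by positivity)]
    nlinarith [mul_pos hc0 hd0]
  refine ⟨t, ht1, ?_⟩
  have h1 : genMean m t - y * gen m t = c * d * t ^ M +
      ∑ i ∈ (evens m).erase M, (m.choose i : ℝ) * (i - y) * t ^ i := by
    rw [gen_eq_sum, genMean, mul_sum, ← sum_sub_distrib, ← add_sum_erase _ _ hMe]
    congr 1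
    · simp only [hc, hd]; ring
    · exact sum_congr rfl fun i _ => by ring
  have h2 : -(B * t ^ (M - 1)) ≤
      ∑ i ∈ (evens m).erase M, (m.choose i : ℝ) * (i - y) * t ^ i := by
    rw [hB, sum_mul, ← sum_neg_distrib]
    refine sum_le_sum fun i hi => ?_
    have h3 : t ^ i ≤ t ^ (M - 1) := pow_le_pow_right₀ ht1 (by have := hlt i hi; omega)
    have h4 : -|y - i| ≤ i - y := by
      have := le_abs_self (y - i)
      linarith
    have h5 : 0 ≤ t ^ i := by positivity
    have h6 : (0 : ℝ) ≤ m.choose i := by positivity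
    calc -((m.choose i : ℝ) * |y - i| * t ^ (M - 1)) ≤ -((m.choose i : ℝ) * |y - i| * t ^ i) :=
          neg_le_neg (mul_le_mul_of_nonneg_left h3 (by positivity))
      _ = (m.choose i : ℝ) * (-|y - i|) * t ^ i := by ring
      _ ≤ _ := mul_le_mul_of_nonneg_right (mul_le_mul_of_nonneg_left h4 h6) h5
  rcases Nat.eq_zero_or_pos M with h0 | h0
  · have : (evens m).erase M = ∅ := by
      rw [eq_empty_iff_forall_notMem]
      intro i hi
      have := hlt i hi
      omega
    rw [this, sum_empty] at h1
    have : 0 < c * d * t ^ M := by positivity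
    linarith
  · have h3 : t ^ M = t * t ^ (M - 1) := by
      rw [← pow_succ', Nat.sub_add_cancel h0]
    have h4 : 0 < t ^ (M - 1) := by positivity
    rw [h3] at h1
    nlinarith [mul_pos (sub_pos.2 htB) h4]

/-- The mean weight grows strictly and continuously from 0 towards the largest even weight 2⌊m/2⌋,
so it takes the value βm exactly once. -/
theorem existsUnique_isPosRoot (hm : 2 ≤ m) {β : ℝ} (h0 : 0 < β)
    (h1 : β * m < (2 * (m / 2) : ℕ)) : ∃! t, IsPosRoot m β t := by
  simp only [isPosRoot_iff (by omega : 1 ≤ m)]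
  have hm' : (0 : ℝ) < m := by positivity
  obtain ⟨u, hu1, hu⟩ := exists_lt_genMean h1
  have hc : ContinuousOn (fun t => genMean m t - β * m * gen m t) (Set.Icc 0 u) :=
    ((continuous_genMean m).sub (continuous_const.mul (continuous_gen m))).continuousOn
  have h00 : genMean m 0 - β * m * gen m 0 < 0 := by
    have e1 : genMean m 0 = 0 := by
      refine sum_eq_zero fun i _ => ?_
      rcases Nat.eq_zero_or_pos i with rfl | h
      · simp
      · simp [h.ne']
    have : 0 < β * m * gen m 0 := by have := gen_pos m le_rfl; positivity
    rw [e1]; linarith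
  obtain ⟨t, ht, hteq⟩ := intermediate_value_Icc (by linarith) hc
    (show (0 : ℝ) ∈ Set.Icc _ _ from ⟨h00.le, by linarith⟩)
  have ht0 : 0 < t := by
    rcases ht.1.eq_or_lt with h | h
    · rw [← h] at hteq
      exact absurd hteq h00.ne
    · exact h
  simp only at hteq
  refine ⟨t, ⟨ht0, by linarith⟩, ?_⟩
  rintro v ⟨hv0, hv⟩
  have key : ∀ a b : ℝ, 0 < a → genMean m a = β * m * gen m a → genMean m b = β * m * gen m b →
      ¬ a < b := by
    intro a b ha h1 h2 hab
    have := genMean_mul_gen_lt hm ha hab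
    rw [h1, h2] at this
    nlinarith
  exact le_antisymm (not_lt.1 (key t v ht0 (by linarith) hv))
    (not_lt.1 (key v t hv0 hv (by linarith)))

/-- The largest even weight is m for even m and m - 1 for odd m; this is the source of the
convention q = -∞. -/
lemma mul_lt_two_mul_half (hm : 1 ≤ m) {β : ℝ} :
    β * m < (2 * (m / 2) : ℕ) ↔ β < 1 ∧ ¬ (Odd m ∧ 1 - 1 / (m : ℝ) ≤ β) := by
  have hm' : (0 : ℝ) < m := by positivity
  rcases Nat.even_or_odd m with h | h
  · have h2 : 2 * (m / 2) = m := Nat.two_mul_div_two_of_even h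
    rw [h2]
    simp only [Nat.not_odd_iff_even.2 h, false_and, not_false_eq_true, and_true]
    constructor <;> intro h3 <;> nlinarith
  · have h2 : 2 * (m / 2) + 1 = m := Nat.two_mul_div_two_add_one_of_odd h
    have h3 : ((2 * (m / 2) : ℕ) : ℝ) = m - 1 := by
      rw [eq_sub_iff_add_eq]; exact_mod_cast h2
    have h4 : (1 - 1 / (m : ℝ)) * m = m - 1 := by field_simp
    rw [h3]
    simp only [h, true_and, not_le]
    constructor
    · intro h5
      constructor <;> nlinarith
    · rintro ⟨_, h5⟩
      nlinarith

end Generating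

/-! ### Coefficient bounds and Stirling estimates -/

section Weights

variable {m r : ℕ}

lemma sum_evenWt (m r : ℕ) (t : ℝ) :
    ∑ k ∈ range (m * r + 1), (evenWt m r k : ℝ) * t ^ k = gen m t ^ r := by
  have h1 : gen m t ^ r = ∑ a ∈ evenTypes m r, ∏ i, ((m.choose (a i) : ℝ) * t ^ a i) := by
    have h2 := prod_univ_sum (fun _ : Fin r => evens m) fun _ j => (m.choose j : ℝ) * t ^ j
    rw [prod_const, card_univ, Fintype.card_fin, ← gen_eq_sum] at h2
    exact h2
  rw [h1, ← sum_fiberwise_of_maps_to (s := evenTypes m r) (t := range (m * r + 1))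
    (g := fun a => ∑ i, a i)]
  · refine sum_congr rfl fun k _ => ?_
    rw [evenWt, Nat.cast_sum, sum_mul]
    refine sum_congr rfl fun a ha => ?_
    rw [← (mem_filter.1 ha).2, Nat.cast_prod, ← prod_pow_eq_pow_sum, prod_mul_distrib]
  · intro a ha
    simp only [evenTypes, Fintype.mem_piFinset, mem_filter, mem_range] at ha
    rw [mem_range, Nat.lt_succ_iff]
    calc ∑ i, a i ≤ ∑ _i : Fin r, m := sum_le_sum fun i _ => by have := (ha i).1; omega
      _ = m * r := by simp [mul_comm]

lemma evenWt_mul_pow_le {k : ℕ} (hk : k ≤ m * r) {t : ℝ} (ht : 0 ≤ t) :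
    (evenWt m r k : ℝ) * t ^ k ≤ gen m t ^ r := by
  rw [← sum_evenWt]
  exact single_le_sum (f := fun k => (evenWt m r k : ℝ) * t ^ k) (fun i _ => by positivity)
    (mem_range.2 (Nat.lt_succ_of_le hk))

lemma even_of_evenWt_ne_zero {k : ℕ} (h : evenWt m r k ≠ 0) : Even k := by
  obtain ⟨a, ha, _⟩ := exists_ne_zero_of_sum_ne_zero h
  simp only [evenTypes, Fintype.mem_piFinset, mem_filter] at ha
  rw [← ha.2]
  exact even_sum _ fun i _ => (ha.1 i).2

/-- Below the maximal total weight some group can receive two more points. For a fixed group this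
map of types is injective and the product of binomials drops by at most a factor 2^m; there are r
groups to choose from. -/
lemma evenWt_le_add_two {k : ℕ} (hk : k < 2 * (m / 2) * r) :
    evenWt m r k ≤ r * 2 ^ m * evenWt m r (k + 2) := by
  set A := (evenTypes m r).filter fun a => ∑ i, a i = k with hA
  have hcover : ∀ a ∈ A, ∃ i, a i + 2 ≤ m := by
    intro a ha
    by_contra! h
    have ha' := ha
    simp only [hA, evenTypes, Fintype.mem_piFinset, mem_filter, mem_range, Nat.even_iff] at ha'
    have : ∑ _i : Fin r, 2 * (m / 2) ≤ ∑ i, a i := sum_le_sum fun i _ => by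
      have h1 := h i
      have h2 := ha'.1 i
      omega
    rw [ha'.2] at this
    simp only [sum_const, card_univ, Fintype.card_fin, smul_eq_mul] at this
    rw [mul_comm r] at this
    omega
  have hone : ∀ i : Fin r, ∑ a ∈ A.filter fun a => a i + 2 ≤ m, ∏ j, m.choose (a j) ≤
      2 ^ m * evenWt m r (k + 2) := by
    intro i
    rw [evenWt, mul_sum]
    have hprod : ∀ a : Fin r → ℕ, a i + 2 ≤ m → ∏ j, m.choose (a j) ≤
        2 ^ m * ∏ j, m.choose (Function.update a i (a i + 2) j) := by
      intro a hai
      rw [← mul_prod_erase univ _ (mem_univ i),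
        ← mul_prod_erase univ (fun j => m.choose (Function.update a i (a i + 2) j)) (mem_univ i)]
      have h1 : ∏ j ∈ univ.erase i, m.choose (Function.update a i (a i + 2) j) =
          ∏ j ∈ univ.erase i, m.choose (a j) :=
        prod_congr rfl fun j hj => by rw [Function.update_of_ne (ne_of_mem_erase hj)]
      rw [h1, Function.update_self, ← mul_assoc]
      refine Nat.mul_le_mul_right _ ((Nat.choose_le_two_pow _ _).trans ?_)
      exact Nat.le_mul_of_pos_right _ (Nat.choose_pos hai)
    refine (sum_le_sum fun a ha => hprod a (mem_filter.1 ha).2).trans ?_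
    rw [← sum_image (f := fun b : Fin r → ℕ => 2 ^ m * ∏ j, m.choose (b j))
      (g := fun a : Fin r → ℕ => Function.update a i (a i + 2))]
    · refine sum_le_sum_of_subset fun b hb => ?_
      obtain ⟨a, ha, rfl⟩ := mem_image.1 hb
      simp only [hA, evenTypes, Fintype.mem_piFinset, mem_filter, mem_range] at ha ⊢
      obtain ⟨⟨h1, h2⟩, h3⟩ := ha
      refine ⟨fun j => ?_, ?_⟩
      · rcases eq_or_ne j i with rfl | hj
        · rw [Function.update_self]
          exact ⟨by omega, (h1 j).2.add even_two⟩
        · rw [Function.update_of_ne hj]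
          exact h1 j
      · rw [sum_update_of_mem (mem_univ i), sdiff_singleton_eq_erase]
        have := add_sum_erase univ a (mem_univ i)
        omega
    · intro a _ b _ hab
      funext j
      rcases eq_or_ne j i with rfl | hj
      · have := congrFun hab j
        simpa using this
      · have := congrFun hab j
        simpa [hj] using this
  calc evenWt m r k = ∑ a ∈ A, ∏ j, m.choose (a j) := rfl
    _ ≤ ∑ a ∈ A, ∑ i : Fin r, if a i + 2 ≤ m then ∏ j, m.choose (a j) else 0 := by
        refine sum_le_sum fun a ha => ?_
        obtain ⟨i, hi⟩ := hcover a ha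
        refine le_trans ?_ (single_le_sum (fun _ _ => Nat.zero_le _) (mem_univ i))
        rw [if_pos hi]
    _ = ∑ i : Fin r, ∑ a ∈ A.filter fun a => a i + 2 ≤ m, ∏ j, m.choose (a j) := by
        rw [sum_comm]
        simp only [sum_filter]
    _ ≤ ∑ _i : Fin r, 2 ^ m * evenWt m r (k + 2) := sum_le_sum fun i _ => hone i
    _ = _ := by simp [mul_assoc]

lemma evenWt_le_add {k j : ℕ} (hk : k + 2 * j ≤ 2 * (m / 2) * r) :
    evenWt m r k ≤ (r * 2 ^ m) ^ j * evenWt m r (k + 2 * j) := by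
  induction j with
  | zero => simp
  | succ j ih =>
    calc _ ≤ (r * 2 ^ m) ^ j * evenWt m r (k + 2 * j) := ih (by omega)
      _ ≤ (r * 2 ^ m) ^ j * (r * 2 ^ m * evenWt m r (k + 2 * j + 2)) :=
        Nat.mul_le_mul_left _ (evenWt_le_add_two (by omega))
      _ = _ := by rw [pow_succ, mul_assoc _ (r * 2 ^ m)]; rfl

/-- The Chernoff bound: the weights `k` of a set on one side of `y * m * r` contribute little to
the generating function at `t`. -/
lemma sum_evenWt_le {t u y : ℝ} (ht : 0 < t) (hu : 0 < u) {K : Finset ℕ}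
    (hK : K ⊆ range (m * r + 1))
    (hy : ∀ k ∈ K, y * (m * r) * (Real.log u - Real.log t) ≤ k * (Real.log u - Real.log t)) :
    ∑ k ∈ K, (evenWt m r k : ℝ) * t ^ k ≤
      (gen m u * Real.exp (-(y * m * (Real.log u - Real.log t)))) ^ r := by
  set L := Real.log u - Real.log t with hL
  rw [mul_pow, ← sum_evenWt, sum_mul]
  refine le_trans ?_ (sum_le_sum_of_subset_of_nonneg hK fun _ _ _ => by positivity)
  refine sum_le_sum fun k hk => ?_
  -- Termwise tᵏ = uᵏ exp(-kL) ≤ uᵏ exp(-y m r L). The sign of L decides whether this bounds the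
  -- upper or the lower tail.
  rw [mul_assoc]
  refine mul_le_mul_of_nonneg_left ?_ (Nat.cast_nonneg _)
  rw [← Real.exp_log (pow_pos ht k), ← Real.exp_log (pow_pos hu k), ← Real.exp_nat_mul,
    ← Real.exp_add, Real.exp_le_exp, Real.log_pow, Real.log_pow]
  have := hy k hk
  rw [hL] at this ⊢
  nlinarith

/-- The bounds `log (n!) = n log n - n + O(log n)`. -/
lemma log_factorial_bounds (n : ℕ) :
    n * Real.log n - n ≤ Real.log n.factorial ∧
      Real.log n.factorial ≤ n * Real.log n - n + 1 + Real.log n := by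
  rcases Nat.eq_zero_or_pos n with rfl | hn
  · simp
  · have hn0 : (1 : ℝ) ≤ n := by exact_mod_cast hn
    have hlog : 0 ≤ Real.log n := Real.log_nonneg hn0
    have hanti : Real.log (Stirling.stirlingSeq n) ≤ Real.log (Stirling.stirlingSeq 1) := by
      obtain ⟨p, rfl⟩ : ∃ p, n = p + 1 := ⟨n - 1, by omega⟩
      exact Stirling.log_stirlingSeq'_antitone (Nat.zero_le p)
    rw [Stirling.log_stirlingSeq_formula, Stirling.stirlingSeq_one, Real.log_div (by positivity)
      (by positivity), Real.log_div (by positivity) (by positivity), Real.log_exp,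
      Real.log_sqrt (by norm_num), Real.log_mul (by norm_num)
      (by positivity)] at hanti
    have hlow := Stirling.le_log_factorial_stirling hn.ne'
    have hpi : 0 ≤ Real.log (2 * Real.pi) := Real.log_nonneg (by linarith [Real.pi_gt_three])
    constructor <;> linarith

lemma mul_binEntropy {N k : ℕ} (hk : k ≤ N) :
    N * Real.binEntropy (k / N) =
      N * Real.log N - k * Real.log k - ((N - k : ℕ) : ℝ) * Real.log (N - k : ℕ) := by
  rcases Nat.eq_zero_or_pos N with rfl | hN
  · obtain rfl : k = 0 := by omega
    simp
  have hN0 : (N : ℝ) ≠ 0 := by positivity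
  have h1 : (1 : ℝ) - k / N = ((N - k : ℕ) : ℝ) / N := by
    rw [Nat.cast_sub hk]; field_simp
  have key : ∀ j : ℕ, (N : ℝ) * Real.negMulLog (j / N) = j * Real.log N - j * Real.log j := by
    intro j
    rcases Nat.eq_zero_or_pos j with rfl | hj
    · simp
    rw [Real.negMulLog, Real.log_div (by positivity) hN0]
    field_simp
    ring
  rw [Real.binEntropy_eq_negMulLog_add_negMulLog_one_sub, h1, mul_add, key, key]
  rw [Nat.cast_sub hk]
  ring

/-- `log (N choose k) = N H(k / N) + O(log N)`. -/
lemma abs_log_choose_sub_le {N k : ℕ} (hk : k ≤ N) :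
    |Real.log (N.choose k) - N * Real.binEntropy (k / N)| ≤ 2 + 2 * Real.log N := by
  rw [mul_binEntropy hk, Nat.choose_eq_factorial_div_factorial hk,
    Nat.cast_div (Nat.factorial_mul_factorial_dvd_factorial hk) (by positivity), Nat.cast_mul,
    Real.log_div (by positivity) (by positivity), Real.log_mul (by positivity) (by positivity)]
  have h1 := log_factorial_bounds N
  have h2 := log_factorial_bounds k
  have h3 := log_factorial_bounds (N - k)
  have hmono : ∀ j : ℕ, j ≤ N → 0 ≤ Real.log j ∧ Real.log j ≤ Real.log N := by
    intro j hj
    refine ⟨Real.log_natCast_nonneg j, ?_⟩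
    rcases Nat.eq_zero_or_pos j with rfl | h
    · simpa using Real.log_natCast_nonneg N
    · exact Real.log_le_log (by positivity) (by exact_mod_cast hj)
  have h4 := hmono k hk
  have h5 := hmono (N - k) (Nat.sub_le _ _)
  have h6 : ((N - k : ℕ) : ℝ) = N - k := Nat.cast_sub hk
  have h7 := hmono N le_rfl
  rw [abs_le]
  constructor <;> linarith [h1.1, h1.2, h2.1, h2.2, h3.1, h3.2]

end Weights

/-! ### Concentration at the saddle point -/

section Rates

variable {ℓ m r : ℕ}

lemma exists_gt_lt_of_hasDerivAt_neg {φ : ℝ → ℝ} {d t : ℝ} (h : HasDerivAt φ d t) (hd : d < 0) :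
    ∃ u, t < u ∧ φ u < φ t := by
  have h1 := (hasDerivAt_iff_tendsto_slope.1 h).eventually (gt_mem_nhds hd)
  have h2 : ∀ᶠ u in 𝓝[>] t, slope φ t u < 0 :=
    h1.filter_mono (nhdsWithin_mono _ fun u hu => ne_of_gt hu)
  obtain ⟨u, hu, hu'⟩ := (h2.and self_mem_nhdsWithin).exists
  have hu'' : t < u := hu'
  refine ⟨u, hu'', ?_⟩
  rw [slope_def_field, div_lt_iff₀ (sub_pos.2 hu'')] at hu
  linarith

lemma exists_lt_lt_of_hasDerivAt_pos {φ : ℝ → ℝ} {d t a : ℝ} (h : HasDerivAt φ d t) (hd : 0 < d)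
    (ha : a < t) : ∃ u, a < u ∧ u < t ∧ φ u < φ t := by
  have h1 := (hasDerivAt_iff_tendsto_slope.1 h).eventually (lt_mem_nhds hd)
  have h2 : ∀ᶠ u in 𝓝[<] t, 0 < slope φ t u :=
    h1.filter_mono (nhdsWithin_mono _ fun u hu => ne_of_lt hu)
  have h3 : ∀ᶠ u in 𝓝[<] t, a < u := (lt_mem_nhds ha).filter_mono nhdsWithin_le_nhds
  obtain ⟨u, ⟨hu, hau⟩, hu'⟩ := ((h2.and h3).and self_mem_nhdsWithin).exists
  have hu'' : u < t := hu'
  refine ⟨u, hau, hu'', ?_⟩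
  rw [slope_def_field, lt_div_iff_of_neg (sub_neg.2 hu'')] at hu
  linarith

lemma hasDerivAt_log_gen {t : ℝ} (ht : 0 < t) (y : ℝ) :
    HasDerivAt (fun u => Real.log (gen m u) - y * Real.log u)
      ((genMean m t / gen m t - y) / t) t := by
  have h1 : HasDerivAt (gen m) (genMean m t / t) t := by
    have h2 : gen m = fun u => ∑ i ∈ evens m, (m.choose i : ℝ) * u ^ i := by
      funext u; exact gen_eq_sum m u
    have h3 : HasDerivAt (fun u : ℝ => ∑ i ∈ evens m, (m.choose i : ℝ) * u ^ i)
        (∑ i ∈ evens m, (m.choose i : ℝ) * (i * t ^ (i - 1))) t :=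
      HasDerivAt.fun_sum fun i _ => (hasDerivAt_pow i t).const_mul _
    rw [h2]
    convert h3 using 1
    rw [genMean, sum_div]
    refine sum_congr rfl fun i _ => ?_
    rcases i with _ | i
    · simp
    · rw [Nat.add_sub_cancel, pow_succ]
      field_simp
  have hg := gen_pos m ht.le
  have e : (genMean m t / gen m t - y) / t = genMean m t / t / gen m t - y * t⁻¹ := by
    field_simp
  rw [e]
  exact (h1.log hg.ne').sub ((Real.hasDerivAt_log ht.ne').const_mul y)

/-- The tail bounds: `gen m t ^ r` is dominated by the weights near `x * m * r`, where `x` is the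
mean relative weight at `t`. -/
lemma exists_evenWt_mul_pow_ge (hm : 1 ≤ m) {x t δ : ℝ} (ht : IsPosRoot m x t) (hδ : 0 < δ) :
    ∀ᶠ r : ℕ in atTop, ∃ k ≤ m * r, |(k : ℝ) - x * (m * r)| < δ * (m * r) ∧
      gen m t ^ r / (4 * (m * r + 1)) ≤ evenWt m r k * t ^ k := by
  obtain ⟨ht0, hmean⟩ := (isPosRoot_iff hm).1 ht
  have hg := gen_pos m ht0.le
  have hm' : (0 : ℝ) < m := by positivity
  have hquot : genMean m t / gen m t = x * m := by rw [hmean, mul_div_cancel_right₀ _ hg.ne']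
  have htail : ∀ y u : ℝ, 0 < u →
      Real.log (gen m u) - y * m * Real.log u < Real.log (gen m t) - y * m * Real.log t →
      gen m u * Real.exp (-(y * m * (Real.log u - Real.log t))) < gen m t := by
    intro y u hu h
    have hgu := gen_pos m hu.le
    rw [← Real.exp_log hgu, ← Real.exp_add, ← Real.exp_log hg, Real.exp_lt_exp]
    linarith
  -- At the root the derivative of log `gen` - y m log vanishes for y = x, is negative for y = x + δ
  -- and positive for y = x - δ. Moving t slightly up or down therefore gives Chernoff bases
  -- strictly below `gen m t` for the two tails.
  obtain ⟨u, htu, hu⟩ := exists_gt_lt_of_hasDerivAt_neg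
    (hasDerivAt_log_gen (m := m) ht0 ((x + δ) * m)) (by
      rw [hquot]
      exact div_neg_of_neg_of_pos (by nlinarith) ht0)
  obtain ⟨v, hv0, hvt, hv⟩ := exists_lt_lt_of_hasDerivAt_pos
    (hasDerivAt_log_gen (m := m) ht0 ((x - δ) * m)) (by
      rw [hquot]
      exact div_pos (by nlinarith) ht0) ht0
  have hu0 := ht0.trans htu
  set ρ := gen m u * Real.exp (-((x + δ) * m * (Real.log u - Real.log t))) with hρ
  set σ := gen m v * Real.exp (-((x - δ) * m * (Real.log v - Real.log t))) with hσ
  have hρ1 : ρ < gen m t := htail _ _ hu0 hu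
  have hσ1 : σ < gen m t := htail _ _ hv0 hv
  have hρ0 : 0 < ρ := mul_pos (gen_pos m hu0.le) (Real.exp_pos _)
  have hσ0 : 0 < σ := mul_pos (gen_pos m hv0.le) (Real.exp_pos _)
  have hsmall : ∀ z, 0 < z → z < gen m t → ∀ᶠ r : ℕ in atTop, z ^ r < gen m t ^ r / 4 := by
    intro z hz0 hz
    have := (tendsto_pow_atTop_nhds_zero_of_lt_one (div_pos hz0 hg).le
      ((div_lt_one hg).2 hz)).eventually (gt_mem_nhds (by norm_num : (0 : ℝ) < 1 / 4))
    filter_upwards [this] with r hr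
    rw [div_pow, div_lt_iff₀ (pow_pos hg r)] at hr
    linarith
  filter_upwards [hsmall ρ hρ0 hρ1, hsmall σ hσ0 hσ1] with r hr1 hr2
  have hN : (0 : ℝ) ≤ m * r := by positivity
  set K1 := (range (m * r + 1)).filter fun k : ℕ => (x + δ) * (m * r) ≤ k with hK1
  set K2 := (range (m * r + 1)).filter fun k : ℕ => (k : ℝ) ≤ (x - δ) * (m * r) with hK2
  set K0 := (range (m * r + 1)).filter fun k : ℕ => |(k : ℝ) - x * (m * r)| < δ * (m * r) with hK0
  have b1 : ∑ k ∈ K1, (evenWt m r k : ℝ) * t ^ k ≤ ρ ^ r := by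
    refine sum_evenWt_le ht0 hu0 (filter_subset _ _) fun k hk => ?_
    exact mul_le_mul_of_nonneg_right (mem_filter.1 hk).2
      (sub_nonneg.2 (Real.log_le_log ht0 htu.le))
  have b2 : ∑ k ∈ K2, (evenWt m r k : ℝ) * t ^ k ≤ σ ^ r := by
    refine sum_evenWt_le ht0 hv0 (filter_subset _ _) fun k hk => ?_
    exact mul_le_mul_of_nonpos_right (mem_filter.1 hk).2
      (sub_nonpos.2 (Real.log_le_log hv0 hvt.le))
  have hall : gen m t ^ r ≤ ∑ k ∈ K0, (evenWt m r k : ℝ) * t ^ k +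
      (∑ k ∈ K1, (evenWt m r k : ℝ) * t ^ k + ∑ k ∈ K2, (evenWt m r k : ℝ) * t ^ k) := by
    rw [← sum_evenWt, hK0, hK1, hK2, sum_filter, sum_filter, sum_filter, ← sum_add_distrib,
      ← sum_add_distrib]
    refine sum_le_sum fun k _ => ?_
    have hp : 0 ≤ (evenWt m r k : ℝ) * t ^ k := by positivity
    by_cases h0 : |(k : ℝ) - x * (m * r)| < δ * (m * r)
    · rw [if_pos h0]
      split_ifs <;> linarith
    · rw [if_neg h0]
      rw [abs_lt, not_and_or, not_lt, not_lt] at h0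
      rcases h0 with h0 | h0
      · rw [if_pos (show (k : ℝ) ≤ (x - δ) * (m * r) by linarith)]
        split_ifs <;> linarith
      · rw [if_pos (show (x + δ) * (m * r) ≤ k by linarith)]
        split_ifs <;> linarith
  -- If every central term were below its share, the centre and both tails would each be at most a
  -- quarter of `gen m t ^ r`.
  by_contra! hcon
  have h0 : ∑ k ∈ K0, (evenWt m r k : ℝ) * t ^ k ≤ gen m t ^ r / 4 := by
    calc ∑ k ∈ K0, (evenWt m r k : ℝ) * t ^ k ≤ ∑ _k ∈ K0, gen m t ^ r / (4 * (m * r + 1)) := by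
          refine sum_le_sum fun k hk => ?_
          obtain ⟨hk1, hk2⟩ := mem_filter.1 hk
          exact (hcon k (Nat.lt_succ_iff.1 (mem_range.1 hk1)) hk2).le
      _ ≤ ∑ _k ∈ range (m * r + 1), gen m t ^ r / (4 * (m * r + 1)) :=
          sum_le_sum_of_subset_of_nonneg (filter_subset _ _) fun _ _ _ => by positivity
      _ = gen m t ^ r / 4 := by
          rw [sum_const, card_range, nsmul_eq_mul]
          push_cast
          field_simp
  have := pow_pos hg r
  linarith

/-- At the saddle point the weights divisible by `ℓ` attain the exponential rate. -/
lemma exists_evenWt_ge (hm : 1 ≤ m) (hℓ : 1 ≤ ℓ) {x t δ ε : ℝ} (ht : IsPosRoot m x t)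
    (hx : x * m < (2 * (m / 2) : ℕ)) (hδ : 0 < δ) (hε : 0 < ε) :
    ∀ᶠ r : ℕ in atTop, ∃ k ≤ m * r, ℓ ∣ k ∧ |(k : ℝ) / (m * r : ℕ) - x| < δ ∧
      Real.exp (r * (Real.log (gen m t) - ε)) ≤ evenWt m r k * t ^ k := by
  have ht0 : 0 < t := ht.1
  have hg := gen_pos m ht0.le
  have hm' : (0 : ℝ) < m := by positivity
  set η : ℝ := (2 * (m / 2) : ℕ) - x * m with hη
  have hη0 : 0 < η := by linarith
  -- Half of δ is kept for the later shift of k by at most 2ℓ; the other bound keeps the shifted k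
  -- below the maximal weight 2⌊m/2⌋r.
  set δ' : ℝ := min (δ / 2) (η / (2 * m)) with hδ'
  have hδ'0 : 0 < δ' := lt_min (by positivity) (by positivity)
  have hδ'1 : δ' ≤ δ / 2 := min_le_left _ _
  have hδ'2 : δ' * m ≤ η / 2 := by
    have : δ' ≤ η / (2 * m) := min_le_right _ _
    rw [le_div_iff₀ (by positivity)] at this
    linarith
  set c : ℝ := min 1 t ^ (2 * ℓ) with hc
  have hc0 : 0 < c := pow_pos (lt_min one_pos ht0) _
  have hpoly : ∀ᶠ r : ℕ in atTop,
      4 * (m + 1) * (2 ^ m) ^ ℓ * ((r : ℝ) ^ (ℓ + 1) * Real.exp (-ε) ^ r) < c := by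
    have := (tendsto_pow_const_mul_const_pow_of_abs_lt_one (ℓ + 1) (r := Real.exp (-ε)) (by
      rw [abs_of_pos (Real.exp_pos _)]
      exact Real.exp_lt_one_iff.2 (by linarith))).const_mul (4 * (m + 1) * (2 ^ m) ^ ℓ : ℝ)
    rw [mul_zero] at this
    exact this.eventually (gt_mem_nhds hc0)
  have hcast := tendsto_natCast_atTop_atTop (R := ℝ)
  filter_upwards [exists_evenWt_mul_pow_ge hm ht hδ'0, hpoly, eventually_ge_atTop 1,
    hcast.eventually_gt_atTop (2 * ℓ / (η / 2)),
    hcast.eventually_gt_atTop (2 * ℓ / (m * (δ / 2)))] with r hr hr1 hr2 hr3 hr4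
  obtain ⟨k, hk, hkx, hkw⟩ := hr
  have hr0 : (1 : ℝ) ≤ r := by exact_mod_cast hr2
  have hwne : evenWt m r k ≠ 0 := by
    intro h0
    rw [h0, Nat.cast_zero, zero_mul] at hkw
    have : 0 < gen m t ^ r / (4 * (m * r + 1)) := by positivity
    linarith
  obtain ⟨k', hk'⟩ := even_of_evenWt_ne_zero hwne
  -- The central k is even, k = 2k'. Raising it in steps of two until ℓ divides k' + j makes it
  -- divisible by ℓ, at the cost of a polynomial factor.
  obtain ⟨j, hj, hdvd⟩ : ∃ j ≤ ℓ, ℓ ∣ k' + j := by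
    refine ⟨ℓ - k' % ℓ, Nat.sub_le _ _, ?_⟩
    have h1 := Nat.mod_lt k' (show 0 < ℓ by omega)
    have h2 := Nat.div_add_mod k' ℓ
    exact ⟨k' / ℓ + 1, by rw [mul_add]; omega⟩
  rw [div_lt_iff₀ (by positivity)] at hr3 hr4
  rw [abs_lt] at hkx
  have hjR : (j : ℝ) ≤ ℓ := by exact_mod_cast hj
  have hKle : k + 2 * j ≤ 2 * (m / 2) * r := by
    have : ((k + 2 * j : ℕ) : ℝ) ≤ (2 * (m / 2) * r : ℕ) := by
      rw [Nat.cast_mul (2 * (m / 2)) r]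
      have : ((2 * (m / 2) : ℕ) : ℝ) = η + x * m := by rw [hη]; ring
      rw [this]
      push_cast
      nlinarith [mul_le_mul_of_nonneg_right hδ'2 (by linarith : (0 : ℝ) ≤ r)]
    exact_mod_cast this
  have hN : (0 : ℝ) < (m * r : ℕ) := by
    push_cast; positivity
  refine ⟨k + 2 * j, hKle.trans (Nat.mul_le_mul_right _ (Nat.mul_div_le m 2)), ?_, ?_, ?_⟩
  · have : k + 2 * j = (k' + j) * 2 := by omega
    rw [this]
    exact hdvd.mul_right 2
  · rw [abs_lt, lt_sub_iff_add_lt, sub_lt_iff_lt_add, lt_div_iff₀ hN, div_lt_iff₀ hN]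
    push_cast
    have hmr : (0 : ℝ) < m * r := by positivity
    have h5 := mul_le_mul_of_nonneg_right hδ'1 hmr.le
    have hj0 : (0 : ℝ) ≤ j := Nat.cast_nonneg j
    constructor <;> nlinarith
  · have hstep := evenWt_le_add (m := m) (r := r) hKle
    have hstep' : (evenWt m r k : ℝ) ≤ (r * 2 ^ m) ^ ℓ * evenWt m r (k + 2 * j) := by
      have h1 : (evenWt m r k : ℝ) ≤ (r * 2 ^ m) ^ j * evenWt m r (k + 2 * j) := by
        exact_mod_cast hstep
      refine h1.trans (mul_le_mul_of_nonneg_right (pow_le_pow_right₀ ?_ hj) (Nat.cast_nonneg _))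
      have : (1 : ℝ) ≤ 2 ^ m := one_le_pow₀ (by norm_num)
      nlinarith
    have htj : c ≤ t ^ (2 * j) := by
      rw [hc]
      calc min 1 t ^ (2 * ℓ) ≤ min 1 t ^ (2 * j) :=
            pow_le_pow_of_le_one (le_min zero_le_one ht0.le) (min_le_left _ _) (by omega)
        _ ≤ t ^ (2 * j) := pow_le_pow_left₀ (le_min zero_le_one ht0.le) (min_le_right _ _) _
    have hexp : Real.exp (r * (Real.log (gen m t) - ε)) = gen m t ^ r * Real.exp (-ε) ^ r := by
      rw [sub_eq_add_neg, Real.exp_nat_mul, Real.exp_add, Real.exp_log hg, mul_pow]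
    rw [hexp]
    set P : ℝ := 4 * (m * r + 1) * (r * 2 ^ m) ^ ℓ with hP
    have hP0 : 0 < P := by positivity
    have h1 : P * Real.exp (-ε) ^ r ≤ c := by
      refine le_trans ?_ hr1.le
      have : P ≤ 4 * (m + 1) * (2 ^ m) ^ ℓ * (r : ℝ) ^ (ℓ + 1) := by
        rw [hP, mul_pow, pow_succ]
        have h2 : (m * r + 1 : ℝ) ≤ (m + 1) * r := by linarith
        calc 4 * (m * r + 1) * ((r : ℝ) ^ ℓ * (2 ^ m) ^ ℓ)
            ≤ 4 * ((m + 1) * r) * ((r : ℝ) ^ ℓ * (2 ^ m) ^ ℓ) := by gcongr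
          _ = _ := by ring
      rw [← mul_assoc]
      exact mul_le_mul_of_nonneg_right this (by positivity)
    rw [div_le_iff₀ (by positivity)] at hkw
    have h2 : gen m t ^ r * c ≤ P * (evenWt m r (k + 2 * j) * t ^ (k + 2 * j)) := by
      calc gen m t ^ r * c ≤ (evenWt m r k * t ^ k * (4 * (m * r + 1))) * t ^ (2 * j) := by
            gcongr
        _ ≤ ((r * 2 ^ m) ^ ℓ * evenWt m r (k + 2 * j) * t ^ k * (4 * (m * r + 1))) *
            t ^ (2 * j) := by gcongr
        _ = _ := by rw [hP, pow_add]; ring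
    have h3 : P * (gen m t ^ r * Real.exp (-ε) ^ r) ≤
        P * (evenWt m r (k + 2 * j) * t ^ (k + 2 * j)) := by
      refine le_trans ?_ h2
      calc P * (gen m t ^ r * Real.exp (-ε) ^ r) = gen m t ^ r * (P * Real.exp (-ε) ^ r) := by ring
        _ ≤ _ := by gcongr
    exact le_of_mul_le_mul_left h3 hP0

end Rates

/-! ### Exponential bounds for both ensembles -/

section EnsembleRates

variable {ℓ m : ℕ}

/-- The exponential rate (in nats) of the probability that a word of relative weight `x` belongs to
the code, before optimization over `t`. -/
noncomputable def rate (ℓ m : ℕ) (t x : ℝ) : ℝ :=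
  (ℓ / m : ℝ) * (Real.log (gen m t) - x * m * Real.log t) - ℓ * Real.binEntropy x

lemma ratio_le {r k : ℕ} (hk : k ≤ m * r) {t : ℝ} (ht : 0 < t) :
    (evenWt m r k : ℝ) / (m * r).choose k ≤ Real.exp (r * Real.log (gen m t) - k * Real.log t -
      (m * r : ℕ) * Real.binEntropy (k / (m * r : ℕ)) + (2 + 2 * Real.log (m * r : ℕ))) := by
  have hC : (0 : ℝ) < (m * r).choose k := by exact_mod_cast Nat.choose_pos hk
  have hg := gen_pos m ht.le
  have h1 := (abs_le.1 (abs_log_choose_sub_le hk)).1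
  have h2 : (evenWt m r k : ℝ) ≤ Real.exp (r * Real.log (gen m t) - k * Real.log t) := by
    rw [Real.exp_sub, le_div_iff₀ (Real.exp_pos _), Real.exp_nat_mul, Real.exp_nat_mul,
      Real.exp_log hg, Real.exp_log ht]
    exact evenWt_mul_pow_le hk ht.le
  rw [div_le_iff₀ hC, ← Real.exp_log hC, ← Real.exp_add]
  refine h2.trans (Real.exp_le_exp.2 ?_)
  linarith

lemma le_ratio {r k : ℕ} (hk : k ≤ m * r) {t ε : ℝ} (ht : 0 < t)
    (h : Real.exp (r * (Real.log (gen m t) - ε)) ≤ evenWt m r k * t ^ k) :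
    Real.exp (r * Real.log (gen m t) - k * Real.log t -
      (m * r : ℕ) * Real.binEntropy (k / (m * r : ℕ)) - (2 + 2 * Real.log (m * r : ℕ)) - r * ε) ≤
      (evenWt m r k : ℝ) / (m * r).choose k := by
  have hC : (0 : ℝ) < (m * r).choose k := by exact_mod_cast Nat.choose_pos hk
  have h1 := (abs_le.1 (abs_log_choose_sub_le hk)).2
  have h2 : Real.exp (r * (Real.log (gen m t) - ε) - k * Real.log t) ≤ evenWt m r k := by
    rw [Real.exp_sub, Real.exp_nat_mul (Real.log t), Real.exp_log ht, div_le_iff₀ (pow_pos ht k)]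
    exact h
  rw [le_div_iff₀ hC, ← Real.exp_log hC, ← Real.exp_add]
  refine le_trans (Real.exp_le_exp.2 ?_) h2
  linarith

lemma eventually_add_log_le (c d : ℝ) {ε : ℝ} (hε : 0 < ε) :
    ∀ᶠ n : ℕ in atTop, c + d * Real.log n ≤ ε * n := by
  have hcast := tendsto_natCast_atTop_atTop (R := ℝ)
  have h1 := (Real.isLittleO_log_id_atTop.comp_tendsto hcast).bound
    (show 0 < ε / (2 * (|d| + 1)) by positivity)
  filter_upwards [h1, hcast.eventually_ge_atTop (2 * |c| / ε), hcast.eventually_ge_atTop 1]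
    with n h1 h2 h3
  simp only [Function.comp_apply, id_eq, Real.norm_eq_abs] at h1
  rw [abs_of_nonneg (by linarith : (0 : ℝ) ≤ n)] at h1
  rw [div_le_iff₀ hε] at h2
  have h4 : d * Real.log n ≤ (|d| + 1) * |Real.log n| := by
    calc d * Real.log n ≤ |d * Real.log n| := le_abs_self _
      _ = |d| * |Real.log n| := abs_mul _ _
      _ ≤ _ := by nlinarith [abs_nonneg (Real.log (n : ℝ))]
  have h5 : (|d| + 1) * |Real.log n| ≤ ε / 2 * n := by
    calc (|d| + 1) * |Real.log n| ≤ (|d| + 1) * (ε / (2 * (|d| + 1)) * n) := by gcongr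
      _ = _ := by field_simp
  linarith [le_abs_self c]

/-- Here r = ℓn/m and ℓw/(mr) = w/n. In 𝔹 the same exponent comes from ℓ blocks with s = n/m, which
is why the two ensembles share one limit. -/
lemma mul_rateA {r n w : ℕ} (hm : 1 ≤ m) (hℓ : 1 ≤ ℓ) (hn : 1 ≤ n) (h : m * r = ℓ * n) (t : ℝ) :
    r * Real.log (gen m t) - (ℓ * w : ℕ) * Real.log t -
      (m * r : ℕ) * Real.binEntropy ((ℓ * w : ℕ) / (m * r : ℕ)) = n * rate ℓ m t (w / n) := by
  have hm' : (m : ℝ) ≠ 0 := by positivity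
  have hℓ' : (ℓ : ℝ) ≠ 0 := by positivity
  have hn' : (n : ℝ) ≠ 0 := by positivity
  have hr : (r : ℝ) = ℓ * n / m := by
    rw [eq_div_iff hm', mul_comm]; exact_mod_cast h
  rw [h, Nat.cast_mul, Nat.cast_mul, mul_div_mul_left _ _ hℓ', rate, hr]
  field_simp

lemma mul_rateB {s w : ℕ} (hm : 1 ≤ m) (hs : 1 ≤ s) (t : ℝ) :
    ℓ * (s * Real.log (gen m t) - w * Real.log t -
      (m * s : ℕ) * Real.binEntropy (w / (m * s : ℕ))) =
      (m * s : ℕ) * rate ℓ m t (w / (m * s : ℕ)) := by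
  have hm' : (m : ℝ) ≠ 0 := by positivity
  have hs' : (s : ℝ) ≠ 0 := by positivity
  rw [rate]
  push_cast
  field_simp

lemma log_polyFactor_le (hℓ : 1 ≤ ℓ) {ε : ℝ} (hε : 0 < ε) :
    ∀ᶠ n : ℕ in atTop, 0 < polyFactor ℓ m n ∧
      Real.log (polyFactor ℓ m n) + (2 + 2 * Real.log (ℓ * n : ℕ)) ≤ ε * n := by
  set K := 2 * (8 * ℓ * m) with hK
  filter_upwards [eventually_add_log_le (Real.log 2 + K * Real.log ℓ + 2 + 2 * Real.log ℓ) (K + 2) hε,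
    eventually_ge_atTop 1] with n h hn
  have hn' : (n : ℝ) ≠ 0 := by positivity
  have hℓ' : (ℓ : ℝ) ≠ 0 := by positivity
  have hpos : 0 < polyFactor ℓ m n := by unfold polyFactor; positivity
  refine ⟨hpos, ?_⟩
  rw [polyFactor, Real.log_mul (by norm_num) (by positivity), Real.log_pow, ← hK,
    Nat.cast_mul n ℓ, Nat.cast_mul ℓ n, Real.log_mul hn' hℓ', Real.log_mul hℓ' hn']
  linarith

/-- The errors absorbed by ε depend on neither S nor t, so the threshold on n is uniform and t may
later be chosen according to |S|. -/
lemma probA_upper (hm : 1 ≤ m) (hℓ : 2 ≤ ℓ) {ε : ℝ} (hε : 0 < ε) :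
    ∀ᶠ n : ℕ in atTop, ∀ r, m * r = ℓ * n → ∀ S : Finset (Fin n), ∀ t : ℝ, 0 < t →
      probA ℓ m r n S ≤ Real.exp (n * (rate ℓ m t (S.card / n) + ε)) := by
  filter_upwards [log_polyFactor_le (m := m) (by omega : 1 ≤ ℓ) hε, eventually_gt_atTop (2 * m)]
    with n ⟨hD, hn⟩ hn2 r h S t ht
  have hk : ℓ * S.card ≤ m * r := by
    rw [h]; exact Nat.mul_le_mul_left _ (by simpa using card_le_univ S)
  refine (probA_le hℓ hn2 h S).trans ?_
  refine (mul_le_mul_of_nonneg_left (ratio_le hk ht) hD.le).trans ?_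
  rw [mul_rateA hm (by omega) (by omega) h]
  nth_rw 1 [← Real.exp_log hD]
  rw [← Real.exp_add, Real.exp_le_exp]
  rw [← h] at hn
  linarith

lemma probA_lower (hm : 1 ≤ m) (hℓ : 2 ≤ ℓ) {x t δ ε : ℝ} (ht : IsPosRoot m x t)
    (hx0 : 0 < x) (hx : x * m < (2 * (m / 2) : ℕ)) (hδ : 0 < δ) (hε : 0 < ε) :
    ∀ᶠ n : ℕ in atTop, ∀ r, m * r = ℓ * n → ∃ w : ℕ, |(w : ℝ) / n - x| < δ ∧
      ∀ S : Finset (Fin n), S.card = w →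
        Real.exp (n * (rate ℓ m t (w / n) - ε)) ≤ probA ℓ m r n S := by
  have hm' : (0 : ℝ) < m := by positivity
  have hℓ' : (0 : ℝ) < ℓ := by positivity
  have hx1 : x < 1 := ((mul_lt_two_mul_half hm).1 hx).1
  -- Keeping w/n away from 0 and 1 makes S and its complement larger than 2m, as switching requires.
  set δ' := min δ (min (x / 2) ((1 - x) / 2)) with hδ'
  have hδ'0 : 0 < δ' := lt_min hδ (lt_min (by linarith) (by linarith))
  have hε' : 0 < m * ε / (2 * ℓ) := by positivity
  obtain ⟨r₀, hr₀⟩ := eventually_atTop.1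
    (exists_evenWt_ge (ℓ := ℓ) hm (by omega) ht hx hδ'0 hε')
  have hcast := tendsto_natCast_atTop_atTop (R := ℝ)
  filter_upwards [log_polyFactor_le (m := m) (by omega : 1 ≤ ℓ) (half_pos hε),
    eventually_gt_atTop (2 * m), eventually_ge_atTop (m * r₀),
    hcast.eventually_gt_atTop (2 * m / (x / 2)), hcast.eventually_gt_atTop (2 * m / ((1 - x) / 2))]
    with n ⟨hD, hn⟩ hn2 hn3 hn4 hn5 r h
  have hn0 : (0 : ℝ) < n := by
    have : 0 < n := by omega
    exact_mod_cast this
  have hrr : r₀ ≤ r := by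
    have : m * r₀ ≤ m * r := by
      rw [h]; exact hn3.trans (Nat.le_mul_of_pos_left _ (by omega))
    exact Nat.le_of_mul_le_mul_left this (by omega)
  obtain ⟨k, hk, ⟨w, rfl⟩, hkx, hkw⟩ := hr₀ r hrr
  have hwn : ((ℓ * w : ℕ) : ℝ) / (m * r : ℕ) = w / n := by
    rw [h, Nat.cast_mul, Nat.cast_mul, mul_div_mul_left _ _ hℓ'.ne']
  rw [hwn] at hkx
  refine ⟨w, hkx.trans_le (min_le_left _ _), ?_⟩
  rintro S rfl
  have h1 : |(S.card : ℝ) / n - x| < x / 2 :=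
    hkx.trans_le ((min_le_right _ _).trans (min_le_left _ _))
  have h2 : |(S.card : ℝ) / n - x| < (1 - x) / 2 :=
    hkx.trans_le ((min_le_right _ _).trans (min_le_right _ _))
  rw [abs_lt] at h1 h2
  rw [div_lt_iff₀ (by linarith)] at hn4 hn5
  have h3 : x / 2 * n < S.card := by
    rw [← lt_div_iff₀ hn0]; linarith
  have h4 : (S.card : ℝ) < n - (1 - x) / 2 * n := by
    have : (S.card : ℝ) / n < 1 - (1 - x) / 2 := by linarith
    rw [div_lt_iff₀ hn0] at this
    linarith
  have hS : 2 * m < S.card := by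
    have : ((2 * m : ℕ) : ℝ) < S.card := by push_cast; linarith
    exact_mod_cast this
  have hS' : 2 * m + S.card < n := by
    have : ((2 * m + S.card : ℕ) : ℝ) < n := by push_cast; linarith
    exact_mod_cast this
  refine le_trans ?_ (le_probA hℓ hn2 h S hS hS')
  refine le_trans ?_ (mul_le_mul_of_nonneg_left (le_ratio hk ht.1 hkw) (inv_pos.2 hD).le)
  rw [mul_rateA hm (by omega) (by omega) h]
  nth_rw 1 [← Real.exp_log hD]
  rw [← Real.exp_neg, ← Real.exp_add, Real.exp_le_exp]
  have hr : (r : ℝ) = ℓ * n / m := by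
    rw [eq_div_iff hm'.ne', mul_comm]; exact_mod_cast h
  have h5 : r * (m * ε / (2 * ℓ)) = ε / 2 * n := by
    rw [hr]; field_simp
  rw [h5, h]
  linarith

/-- The probability that a given word of weight `w` satisfies the checks of a random Gallager
matrix. -/
noncomputable def probB (ℓ m s w : ℕ) : ℝ := ((evenWt m s w : ℝ) / (m * s).choose w) ^ ℓ

lemma probB_upper (hm : 1 ≤ m) {ε : ℝ} (hε : 0 < ε) :
    ∀ᶠ s : ℕ in atTop, ∀ S : Finset (Fin (m * s)), ∀ t : ℝ, 0 < t →
      probB ℓ m s S.card ≤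
        Real.exp ((m * s : ℕ) * (rate ℓ m t (S.card / (m * s : ℕ)) + ε)) := by
  have hmul : Tendsto (fun s => m * s) atTop atTop :=
    tendsto_id.const_mul_atTop' (by omega)
  filter_upwards [hmul.eventually (eventually_add_log_le (ℓ * 2) (ℓ * 2) hε),
    eventually_ge_atTop 1] with s h hs S t ht
  have hk : S.card ≤ m * s := by simpa using card_le_univ S
  refine (pow_le_pow_left₀ (by positivity) (ratio_le hk ht) ℓ).trans ?_
  rw [← Real.exp_nat_mul, Real.exp_le_exp, mul_add, mul_rateB hm hs]
  linarith

lemma probB_lower (hm : 1 ≤ m) (hℓ : 1 ≤ ℓ) {x t δ ε : ℝ} (ht : IsPosRoot m x t)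
    (hx : x * m < (2 * (m / 2) : ℕ)) (hδ : 0 < δ) (hε : 0 < ε) :
    ∀ᶠ s : ℕ in atTop, ∃ w : ℕ, |(w : ℝ) / (m * s : ℕ) - x| < δ ∧
      ∀ S : Finset (Fin (m * s)), S.card = w →
        Real.exp ((m * s : ℕ) * (rate ℓ m t (w / (m * s : ℕ)) - ε)) ≤ probB ℓ m s S.card := by
  have hmul : Tendsto (fun s => m * s) atTop atTop :=
    tendsto_id.const_mul_atTop' (by omega)
  have hm' : (0 : ℝ) < m := by positivity
  have hℓ' : (0 : ℝ) < ℓ := by positivity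
  have hε' : 0 < m * ε / (2 * ℓ) := by positivity
  -- The weight needs no divisibility here, so the divisor is taken to be 1.
  filter_upwards [hmul.eventually (eventually_add_log_le (ℓ * 2) (ℓ * 2) (half_pos hε)),
    eventually_ge_atTop 1, exists_evenWt_ge hm le_rfl ht hx hδ hε'] with s h hs ⟨w, hk, _, hkx, hkw⟩
  refine ⟨w, hkx, ?_⟩
  rintro S rfl
  refine le_trans ?_ (pow_le_pow_left₀ (Real.exp_pos _).le (le_ratio hk ht.1 hkw) ℓ)
  rw [← Real.exp_nat_mul, Real.exp_le_exp, mul_sub (ℓ : ℝ), mul_sub (ℓ : ℝ), mul_rateB hm hs]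
  have h5 : (ℓ : ℝ) * (s * (m * ε / (2 * ℓ))) = ε / 2 * (m * s : ℕ) := by
    push_cast; field_simp
  rw [h5]
  linarith

end EnsembleRates

/-! ### Optimizing the exponent over t -/

section Limit

variable {ℓ m : ℕ}

lemma gen_zero (m : ℕ) : gen m 0 = 1 := by simp [gen]

lemma gen_le {t : ℝ} (ht : 1 ≤ t) : gen m t ≤ 2 ^ m * t ^ (2 * (m / 2)) := by
  rw [gen_eq_sum]
  calc ∑ i ∈ evens m, (m.choose i : ℝ) * t ^ i
      ≤ ∑ i ∈ evens m, (m.choose i : ℝ) * t ^ (2 * (m / 2)) := by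
        refine sum_le_sum fun i hi => mul_le_mul_of_nonneg_left
          (pow_le_pow_right₀ ht ?_) (Nat.cast_nonneg _)
        simp only [evens, mem_filter, mem_range, Nat.even_iff] at hi
        omega
    _ ≤ ∑ i ∈ range (m + 1), (m.choose i : ℝ) * t ^ (2 * (m / 2)) :=
        sum_le_sum_of_subset_of_nonneg (filter_subset _ _) fun _ _ _ => by positivity
    _ = 2 ^ m * t ^ (2 * (m / 2)) := by
        rw [← sum_mul]
        congr 1
        exact_mod_cast Nat.sum_range_choose m

lemma sq_le_gen (hm : 2 ≤ m) {t : ℝ} (ht : 0 ≤ t) : t ^ 2 ≤ gen m t := by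
  rw [gen_eq_sum]
  have h2 : 2 ∈ evens m := by simp [evens]; omega
  refine le_trans ?_ (single_le_sum (f := fun i => (m.choose i : ℝ) * t ^ i)
    (fun i _ => by positivity) h2)
  have : (1 : ℝ) ≤ m.choose 2 := by exact_mod_cast Nat.choose_pos hm
  nlinarith [sq_nonneg t]

/-- Both 1 and t² are at most `gen m t`, hence so is t^y. This bounds the rate from below at small
relative weights, whatever the root is. -/
lemma log_gen_sub_nonneg (hm : 2 ≤ m) {t y : ℝ} (ht : 0 < t) (hy0 : 0 ≤ y) (hy : y ≤ 2) :
    0 ≤ Real.log (gen m t) - y * Real.log t := by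
  have h1 : 0 ≤ Real.log (gen m t) := Real.log_nonneg (one_le_gen m ht.le)
  have h2 : 2 * Real.log t ≤ Real.log (gen m t) := by
    have := Real.log_le_log (pow_pos ht 2) (sq_le_gen hm ht.le)
    rwa [Real.log_pow, Nat.cast_ofNat] at this
  rcases le_total 0 (Real.log t) with h | h <;> nlinarith

lemma isPosRoot_root (hm : 2 ≤ m) {x : ℝ} (h0 : 0 < x) (h1 : x * m < (2 * (m / 2) : ℕ)) :
    IsPosRoot m x (root m x) :=
  Classical.epsilon_spec (existsUnique_isPosRoot hm h0 h1).exists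

lemma q_eq (hm : 2 ≤ m) {x : ℝ} (h0 : 0 < x) (h1 : x * m < (2 * (m / 2) : ℕ)) :
    q m ((ℓ : ℝ) / m) x = ((rate ℓ m (root m x) x / Real.log 2 : ℝ) : EReal) := by
  have hroot := (isPosRoot_root hm h0 h1).1
  have hg := gen_pos m hroot.le
  have hm' : (m : ℝ) ≠ 0 := by positivity
  have hl : Real.log 2 ≠ 0 := (Real.log_pos (by norm_num)).ne'
  rw [q, if_neg ((mul_lt_two_mul_half (by omega)).1 h1).2]
  congr 1
  have h2 : ((1 + root m x) ^ m + (1 - root m x) ^ m) / (2 * root m x ^ (x * (m : ℝ))) =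
      gen m (root m x) / root m x ^ (x * (m : ℝ)) := by
    rw [gen, div_div]
  rw [h2, Real.logb, Real.log_div hg.ne' (Real.rpow_pos_of_pos hroot _).ne',
    Real.log_rpow hroot, h₂, rate]
  field_simp

/-- If the exponents `rate + θ H` at the roots are at most `c'`, then at every relative weight
`y ∈ [0, 1]` of the word inside `J` some `t` gives an exponent close to `c'`. -/
lemma exists_rate_lt (hm : 2 ≤ m) (hℓ : 1 ≤ ℓ) {θ c c' : ℝ} (hθ0 : 0 < θ) (hθ1 : θ ≤ 1) (hc : c' < c)
    (H : ∀ β : ℝ, 0 < β → β < 1 → β * θ * m < (2 * (m / 2) : ℕ) →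
      rate ℓ m (root m (β * θ)) (β * θ) + θ * Real.binEntropy β ≤ c')
    {y : ℝ} (hy0 : 0 ≤ y) (hy1 : y ≤ 1) :
    ∃ t, 0 < t ∧ rate ℓ m t (θ * y) + θ * Real.binEntropy y < c := by
  have hm' : (0 : ℝ) < m := by positivity
  have hM : (1 : ℝ) < (2 * (m / 2) : ℕ) := by
    have : 1 < 2 * (m / 2) := by omega
    exact_mod_cast this
  have hMm : (m : ℝ) < 2 * (2 * (m / 2) : ℕ) := by
    have : m < 2 * (2 * (m / 2)) := by omega
    exact_mod_cast this
  by_contra! hcon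
  rcases hy0.eq_or_lt with rfl | hy0'
  -- At y = 0, letting t → 0 makes the exponent tend to 0, so c ≤ 0; but letting β → 0 in `H` forces
  -- c' ≥ 0.
  · have h1 : c ≤ 0 := by
      have hlim : Tendsto (fun t => (ℓ / m : ℝ) * Real.log (gen m t)) (𝓝[>] 0) (𝓝 0) := by
        have : ContinuousAt (fun t => (ℓ / m : ℝ) * Real.log (gen m t)) 0 :=
          continuousAt_const.mul ((continuous_gen m).continuousAt.log (by simp [gen_zero]))
        have h2 := this.tendsto
        rw [gen_zero, Real.log_one, mul_zero] at h2
        exact h2.mono_left nhdsWithin_le_nhds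
      refine ge_of_tendsto hlim ?_
      filter_upwards [self_mem_nhdsWithin] with t ht
      simpa [rate] using hcon t ht
    have h2 : 0 ≤ c' := by
      have hlim : Tendsto (fun β => -ℓ * Real.binEntropy (β * θ) + θ * Real.binEntropy β)
          (𝓝[>] 0) (𝓝 0) := by
        have : Continuous fun β => -ℓ * Real.binEntropy (β * θ) + θ * Real.binEntropy β := by
          fun_prop
        have h2 := this.tendsto 0
        simp only [zero_mul, Real.binEntropy_zero, mul_zero, add_zero] at h2
        exact h2.mono_left nhdsWithin_le_nhds
      refine le_of_tendsto hlim ?_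
      have hsm : ∀ᶠ β : ℝ in 𝓝[>] 0, β < min (1 : ℝ) (1 / m) :=
        (gt_mem_nhds (lt_min (zero_lt_one' ℝ) (by positivity))).filter_mono nhdsWithin_le_nhds
      filter_upwards [self_mem_nhdsWithin, hsm] with β hβ hβ'
      have hβ0 : 0 < β := hβ
      obtain ⟨hβ1, hβ2⟩ := lt_min_iff.1 hβ'
      rw [lt_div_iff₀ hm'] at hβ2
      have hx : β * θ * m < 1 := by nlinarith [mul_pos hβ0 hm']
      have hβθ : 0 < β * θ := mul_pos hβ0 hθ0
      have h3 := H β hβ0 hβ1 (by linarith)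
      have h4 := log_gen_sub_nonneg hm (isPosRoot_root hm hβθ (by linarith)).1
        (y := β * θ * m) (by positivity) (by linarith)
      rw [rate] at h3
      have h5 : 0 ≤ (ℓ / m : ℝ) * (Real.log (gen m (root m (β * θ))) -
        β * θ * m * Real.log (root m (β * θ))) := mul_nonneg (by positivity) h4
      linarith
    linarith
  · rcases lt_or_ge ((2 * (m / 2) : ℕ) : ℝ) (θ * y * m) with hbig | hle
    -- Beyond the largest even weight, t = exp L with L → ∞ drives the exponent to -∞.
    · have hα : (0 : ℝ) < ℓ / m := by positivity
      set η := θ * y * m - (2 * (m / 2) : ℕ) with hη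
      have hη0 : 0 < η := sub_pos.2 hbig
      set B := c + ℓ * Real.binEntropy (θ * y) - θ * Real.binEntropy y with hB
      obtain ⟨L, hL0, hL⟩ : ∃ L : ℝ, 0 ≤ L ∧ (ℓ / m : ℝ) * (m * Real.log 2 - η * L) < B := by
        have h1 : Tendsto (fun L : ℝ => (ℓ / m : ℝ) * (m * Real.log 2 - η * L)) atTop atBot := by
          refine Tendsto.const_mul_atBot hα ?_
          exact tendsto_atBot_add_const_left _ _ (tendsto_neg_atTop_atBot.comp
            (tendsto_id.const_mul_atTop hη0))
        obtain ⟨L, h2, h3⟩ := ((h1.eventually (eventually_lt_atBot B)).and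
          (eventually_ge_atTop 0)).exists
        exact ⟨L, h3, h2⟩
      have h2 := hcon (Real.exp L) (Real.exp_pos L)
      have h3 := gen_le (m := m) (Real.one_le_exp hL0)
      have h4 : Real.log (gen m (Real.exp L)) ≤ m * Real.log 2 + (2 * (m / 2) : ℕ) * L := by
        refine (Real.log_le_log (gen_pos m (Real.exp_pos L).le) h3).trans ?_
        rw [Real.log_mul (by positivity) (by positivity), Real.log_pow, Real.log_pow,
          Real.log_exp]
      rw [rate, Real.log_exp] at h2
      have h5 : (ℓ / m : ℝ) * (Real.log (gen m (Real.exp L)) - θ * y * m * L) ≤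
          (ℓ / m : ℝ) * (m * Real.log 2 - η * L) := by
        refine mul_le_mul_of_nonneg_left ?_ hα.le
        rw [hη]
        linarith
      linarith
    -- The endpoints y = 1 and θym = 2⌊m/2⌋ are not covered by `H`, so y is replaced by sy with s →
    -- 1 from below. For fixed t the part of the rate without entropy is affine in the weight and
    -- nonnegative at weight 0, so at sy it is at least s times its value at y.
    · set B := c + ℓ * Real.binEntropy (θ * y) - θ * Real.binEntropy y with hB
      have hlim : Tendsto (fun s : ℝ => s * B - ℓ * Real.binEntropy (s * y * θ) +
          θ * Real.binEntropy (s * y)) (𝓝[<] 1) (𝓝 c) := by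
        have : Continuous fun s : ℝ => s * B - ℓ * Real.binEntropy (s * y * θ) +
          θ * Real.binEntropy (s * y) := by fun_prop
        have h2 := this.tendsto 1
        have h3 : 1 * B - ℓ * Real.binEntropy (1 * y * θ) + θ * Real.binEntropy (1 * y) = c := by
          rw [hB, one_mul, one_mul, mul_comm y θ]; ring
        rw [h3] at h2
        exact h2.mono_left nhdsWithin_le_nhds
      refine absurd (le_of_tendsto hlim ?_) (not_le.2 hc)
      have hpos : ∀ᶠ s : ℝ in 𝓝[<] 1, 0 < s := (lt_mem_nhds one_pos).filter_mono nhdsWithin_le_nhds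
      filter_upwards [self_mem_nhdsWithin, hpos] with s hs hs0
      have hs1 : s < 1 := hs
      have hx : s * y * θ * m < (2 * (m / 2) : ℕ) := by
        have : 0 < θ * y * m := by positivity
        nlinarith
      have hsy : 0 < s * y := mul_pos hs0 hy0'
      have h1 := H (s * y) hsy (by nlinarith) hx
      have hr := (isPosRoot_root hm (mul_pos hsy hθ0) hx).1
      set t := root m (s * y * θ) with ht
      have h2 := hcon t hr
      rw [rate] at h1 h2
      have h3 : 0 ≤ (ℓ / m : ℝ) * Real.log (gen m t) :=
        mul_nonneg (by positivity) (Real.log_nonneg (one_le_gen m hr.le))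
      have h4 : B ≤ (ℓ / m : ℝ) * (Real.log (gen m t) - θ * y * m * Real.log t) := by
        rw [hB]; linarith
      have h5 : (ℓ / m : ℝ) * (Real.log (gen m t) - s * y * θ * m * Real.log t) =
          s * ((ℓ / m : ℝ) * (Real.log (gen m t) - θ * y * m * Real.log t)) +
          (1 - s) * ((ℓ / m : ℝ) * Real.log (gen m t)) := by ring
      have h6 := mul_le_mul_of_nonneg_left h4 hs0.le
      have h7 := mul_nonneg (sub_nonneg.2 hs1.le) h3
      linarith

end Limit

/-! ### Summation over the subsets of J -/

section Average

variable {ℓ m : ℕ}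

/-- The exponential lower bound for a sum over the nonempty subsets of `J`. -/
lemma eventually_le_sum {θ β t ε : ℝ} (hθ0 : 0 < θ) (hβ0 : 0 < β) (hβ1 : β < 1)
    (hε : 0 < ε)
    {n : ℕ → ℕ} {J : (k : ℕ) → Finset (Fin (n k))} (hn : Tendsto n atTop atTop)
    (hJ : Tendsto (fun k => ((J k).card : ℝ) / (n k : ℝ)) atTop (𝓝 θ))
    {p : (k : ℕ) → Finset (Fin (n k)) → ℝ} (hp : ∀ k S, 0 ≤ p k S)
    (hlo : ∀ δ : ℝ, 0 < δ → ∀ ε : ℝ, 0 < ε → ∀ᶠ k in atTop, ∃ w : ℕ,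
      |(w : ℝ) / n k - β * θ| < δ ∧ ∀ S : Finset (Fin (n k)), S.card = w →
        Real.exp (n k * (rate ℓ m t (w / n k) - ε)) ≤ p k S) :
    ∀ᶠ k in atTop, Real.exp (n k * (rate ℓ m t (β * θ) + θ * Real.binEntropy β - ε)) ≤
      ∑ S ∈ (J k).powerset.erase ∅, p k S := by
  -- Evaluated at (w/n, |J|/n), since |J|/n only tends to θ; continuity at (βθ, θ) absorbs the
  -- difference.
  set F : ℝ × ℝ → ℝ := fun z => rate ℓ m t z.1 + z.2 * Real.binEntropy (z.1 / z.2) with hF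
  have hFc : ContinuousAt F (β * θ, θ) := by
    have h1 : ContinuousAt (fun z : ℝ × ℝ => z.1 / z.2) (β * θ, θ) :=
      continuousAt_fst.div continuousAt_snd hθ0.ne'
    have h2 : ContinuousAt (fun z : ℝ × ℝ => Real.binEntropy (z.1 / z.2)) (β * θ, θ) :=
      Real.binEntropy_continuous.continuousAt.comp h1
    have h3 : Continuous fun z : ℝ × ℝ => rate ℓ m t z.1 := by
      unfold rate
      fun_prop
    exact h3.continuousAt.add (continuousAt_snd.mul h2)
  have hF0 : F (β * θ, θ) = rate ℓ m t (β * θ) + θ * Real.binEntropy β := by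
    simp only [hF]
    rw [mul_div_cancel_right₀ _ hθ0.ne']
  have hev : ∀ᶠ z in 𝓝 (β * θ, θ), F (β * θ, θ) - ε / 3 < F z ∧ 0 < z.1 ∧ z.1 < z.2 := by
    refine (hFc.eventually (lt_mem_nhds (by linarith))).and ?_
    refine (continuousAt_fst.eventually (lt_mem_nhds (mul_pos hβ0 hθ0))).and ?_
    exact (isOpen_lt continuous_fst continuous_snd).mem_nhds
      (show β * θ < θ by nlinarith)
  obtain ⟨δ, hδ, hball⟩ := Metric.eventually_nhds_iff.1 hev
  have hθk : ∀ᶠ k in atTop, dist (((J k).card : ℝ) / (n k : ℝ)) θ < δ :=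
    (Metric.tendsto_nhds.1 hJ) δ hδ
  filter_upwards [hlo δ hδ (ε / 3) (by positivity), hθk,
    hn.eventually (eventually_add_log_le 2 2 (by positivity : 0 < ε / 3)),
    hn.eventually (eventually_ge_atTop 1)] with k ⟨w, hw, hS⟩ hJk hlog hn1
  have hn0 : (0 : ℝ) < n k := by exact_mod_cast hn1
  obtain ⟨hFz, hz0, hz1⟩ := hball (y := ((w : ℝ) / n k, ((J k).card : ℝ) / n k)) (by
    rw [Prod.dist_eq]
    exact max_lt (by rwa [Real.dist_eq]) hJk)
  simp only at hz0 hz1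
  have hwJ : w < (J k).card := by
    have := (div_lt_div_iff_of_pos_right hn0).1 hz1
    exact_mod_cast this
  have hw0 : 0 < w := by
    have := (div_pos_iff_of_pos_right hn0).1 hz0
    exact_mod_cast this
  have hJn : (J k).card ≤ n k := by simpa using card_le_univ (J k)
  have hJ0 : 0 < (J k).card := by omega
  have hsub : powersetCard w (J k) ⊆ (J k).powerset.erase ∅ := by
    intro S hS
    rw [mem_powersetCard] at hS
    rw [mem_erase, mem_powerset]
    refine ⟨?_, hS.1⟩
    rintro rfl
    rw [card_empty] at hS
    omega
  have hC : (0 : ℝ) < (J k).card.choose w := by exact_mod_cast Nat.choose_pos hwJ.le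
  have hch := (abs_le.1 (abs_log_choose_sub_le hwJ.le)).1
  have hlogJ : Real.log (J k).card ≤ Real.log (n k) :=
    Real.log_le_log (by exact_mod_cast hJ0) (by exact_mod_cast hJn)
  calc Real.exp (n k * (rate ℓ m t (β * θ) + θ * Real.binEntropy β - ε))
      ≤ (J k).card.choose w * Real.exp (n k * (rate ℓ m t (w / n k) - ε / 3)) := by
        nth_rw 1 [← Real.exp_log hC]
        rw [← Real.exp_add, Real.exp_le_exp]
        rw [hF0] at hFz
        simp only [hF] at hFz
        rw [div_div_div_cancel_right₀ hn0.ne'] at hFz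
        have h1 := mul_lt_mul_of_pos_left hFz hn0
        have h2 : (n k : ℝ) * (((J k).card : ℝ) / n k * Real.binEntropy (w / (J k).card)) =
            (J k).card * Real.binEntropy (w / (J k).card) := by field_simp
        rw [mul_add, h2] at h1
        linarith
    _ = ∑ S ∈ powersetCard w (J k), Real.exp (n k * (rate ℓ m t (w / n k) - ε / 3)) := by
        rw [sum_const, card_powersetCard, nsmul_eq_mul]
    _ ≤ ∑ S ∈ powersetCard w (J k), p k S :=
        sum_le_sum fun S hS' => hS S (mem_powersetCard.1 hS').2
    _ ≤ _ := sum_le_sum_of_subset_of_nonneg hsub fun S _ _ => hp k S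

/-- The exponential upper bound for a sum over the nonempty subsets of `J`. -/
lemma eventually_sum_le {θ c c' : ℝ} (hc : c < c')
    {n : ℕ → ℕ} {J : (k : ℕ) → Finset (Fin (n k))} (hn : Tendsto n atTop atTop)
    (hJ : Tendsto (fun k => ((J k).card : ℝ) / (n k : ℝ)) atTop (𝓝 θ))
    {p : (k : ℕ) → Finset (Fin (n k)) → ℝ}
    (hup : ∀ ε : ℝ, 0 < ε → ∀ᶠ k in atTop, ∀ S : Finset (Fin (n k)), ∀ t : ℝ, 0 < t →
      p k S ≤ Real.exp (n k * (rate ℓ m t (S.card / n k) + ε)))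
    (hrate : ∀ y : ℝ, 0 ≤ y → y ≤ 1 →
      ∃ t, 0 < t ∧ rate ℓ m t (θ * y) + θ * Real.binEntropy y < c) :
    ∀ᶠ k in atTop, ∑ S ∈ (J k).powerset.erase ∅, p k S ≤ Real.exp (n k * c') := by
  -- One third each for the probability bound, the binomial coefficient and the number of weights.
  set ε := (c' - c) / 3 with hε
  have hε0 : 0 < ε := by simp only [hε]; linarith
  -- A t that works at (θ, y) works nearby by continuity; compactness of [0, 1] then gives one
  -- neighbourhood of θ for all y.
  have hunif : ∀ᶠ θ' in 𝓝 θ, ∀ y ∈ Set.Icc (0 : ℝ) 1,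
      ∃ t, 0 < t ∧ rate ℓ m t (θ' * y) + θ' * Real.binEntropy y < c := by
    refine isCompact_Icc.eventually_forall_of_forall_eventually fun y hy => ?_
    obtain ⟨t, ht0, ht⟩ := hrate y hy.1 hy.2
    have hcont : Continuous fun z : ℝ × ℝ =>
        rate ℓ m t (z.1 * z.2) + z.1 * Real.binEntropy z.2 := by
      unfold rate
      fun_prop
    filter_upwards [hcont.continuousAt.eventually (gt_mem_nhds ht)] with z hz
    exact ⟨t, ht0, hz⟩
  filter_upwards [hup ε hε0, hJ.eventually hunif,
    hn.eventually (eventually_add_log_le 2 2 hε0),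
    hn.eventually (eventually_add_log_le (Real.log 2) 1 hε0),
    hn.eventually (eventually_ge_atTop 1)] with k hS hy hlog hlog' hn1
  have hn0 : (0 : ℝ) < n k := by exact_mod_cast hn1
  have hJn : (J k).card ≤ n k := by simpa using card_le_univ (J k)
  rcases Nat.eq_zero_or_pos (J k).card with hJ0 | hJ0
  · rw [card_eq_zero.1 hJ0]
    simpa using (Real.exp_pos _).le
  have hJ0' : (0 : ℝ) < (J k).card := by exact_mod_cast hJ0
  have hlogJ : Real.log (J k).card ≤ Real.log (n k) :=
    Real.log_le_log hJ0' (by exact_mod_cast hJn)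
  have hsingle : ∀ S ∈ (J k).powerset, p k S ≤
      Real.exp (n k * (c + ε) - (J k).card * Real.binEntropy (S.card / (J k).card)) := by
    intro S hSJ
    have hcard : S.card ≤ (J k).card := card_le_card (mem_powerset.1 hSJ)
    obtain ⟨t, ht0, ht⟩ := hy ((S.card : ℝ) / (J k).card) ⟨by positivity,
      (div_le_one hJ0').2 (by exact_mod_cast hcard)⟩
    refine (hS S t ht0).trans (Real.exp_le_exp.2 ?_)
    have h1 : ((J k).card : ℝ) / n k * (S.card / (J k).card) = S.card / n k := by field_simp
    rw [h1] at ht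
    have h2 := mul_lt_mul_of_pos_left ht hn0
    have h3 : (n k : ℝ) * (((J k).card : ℝ) / n k * Real.binEntropy (S.card / (J k).card)) =
        (J k).card * Real.binEntropy (S.card / (J k).card) := by field_simp
    rw [mul_add, h3] at h2
    linarith
  calc ∑ S ∈ (J k).powerset.erase ∅, p k S
      ≤ ∑ S ∈ (J k).powerset.erase ∅,
        Real.exp (n k * (c + ε) - (J k).card * Real.binEntropy (S.card / (J k).card)) :=
        sum_le_sum fun S hS' => hsingle S (mem_of_mem_erase hS')
    _ ≤ ∑ S ∈ (J k).powerset,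
        Real.exp (n k * (c + ε) - (J k).card * Real.binEntropy (S.card / (J k).card)) :=
        sum_le_sum_of_subset_of_nonneg (erase_subset _ _) fun _ _ _ => (Real.exp_pos _).le
    _ = ∑ w ∈ range ((J k).card + 1), (J k).card.choose w •
        Real.exp (n k * (c + ε) - (J k).card * Real.binEntropy (w / (J k).card)) :=
        sum_powerset_apply_card (fun w : ℕ =>
          Real.exp (n k * (c + ε) - (J k).card * Real.binEntropy (w / (J k).card)))
    _ ≤ ∑ _w ∈ range ((J k).card + 1), Real.exp (n k * (c + ε) + ε * n k) := by
        refine sum_le_sum fun w hw => ?_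
        have hw' : w ≤ (J k).card := Nat.lt_succ_iff.1 (mem_range.1 hw)
        have hC : (0 : ℝ) < (J k).card.choose w := by exact_mod_cast Nat.choose_pos hw'
        have hch := (abs_le.1 (abs_log_choose_sub_le hw')).2
        rw [nsmul_eq_mul]
        nth_rw 1 [← Real.exp_log hC]
        rw [← Real.exp_add, Real.exp_le_exp]
        linarith
    _ = ((J k).card + 1) * Real.exp (n k * (c + ε) + ε * n k) := by
        rw [sum_const, card_range, nsmul_eq_mul]
        push_cast
        ring
    _ ≤ (2 * n k) * Real.exp (n k * (c + ε) + ε * n k) := by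
        refine mul_le_mul_of_nonneg_right ?_ (Real.exp_pos _).le
        have h1 : ((J k).card : ℝ) ≤ n k := by exact_mod_cast hJn
        have h2 : (1 : ℝ) ≤ n k := by exact_mod_cast hn1
        linarith
    _ ≤ Real.exp (n k * c') := by
        nth_rw 1 [← Real.exp_log (by positivity : (0 : ℝ) < 2 * n k)]
        rw [← Real.exp_add, Real.exp_le_exp, Real.log_mul (by norm_num) hn0.ne']
        have : c' = c + 3 * ε := by simp only [hε]; ring
        rw [this]
        linarith

/-- The exponent of the average null-free size of a shortened code, from exponential bounds on the
probability that a word belongs to the code. -/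
theorem tendsto_log_average (hℓ : 1 ≤ ℓ) (hm : 2 ≤ m) {θ : ℝ} (hθ0 : 0 < θ) (hθ1 : θ ≤ 1)
    {n : ℕ → ℕ} {J : (k : ℕ) → Finset (Fin (n k))} (hn : Tendsto n atTop atTop)
    (hJ : Tendsto (fun k => ((J k).card : ℝ) / (n k : ℝ)) atTop (𝓝 θ))
    {p : (k : ℕ) → Finset (Fin (n k)) → ℝ} (hp : ∀ k S, 0 ≤ p k S)
    (hup : ∀ ε : ℝ, 0 < ε → ∀ᶠ k in atTop, ∀ S : Finset (Fin (n k)), ∀ t : ℝ, 0 < t →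
      p k S ≤ Real.exp (n k * (rate ℓ m t (S.card / n k) + ε)))
    (hlo : ∀ x t : ℝ, IsPosRoot m x t → 0 < x → x * m < (2 * (m / 2) : ℕ) →
      ∀ δ : ℝ, 0 < δ → ∀ ε : ℝ, 0 < ε → ∀ᶠ k in atTop, ∃ w : ℕ,
      |(w : ℝ) / n k - x| < δ ∧ ∀ S : Finset (Fin (n k)), S.card = w →
        Real.exp (n k * (rate ℓ m t (w / n k) - ε)) ≤ p k S)
    {a : ℕ → ℝ} (ha : ∀ k, a k = ∑ S ∈ (J k).powerset.erase ∅, p k S) :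
    (∀ᶠ k in atTop, 0 < a k) ∧
      Tendsto (fun k => ((1 / (n k : ℝ) * Real.logb 2 (a k) : ℝ) : EReal)) atTop
        (𝓝 (f ℓ m θ)) := by
  have hm' : (0 : ℝ) < m := by positivity
  have hl : 0 < Real.log 2 := Real.log_pos (by norm_num)
  have hlower : ∀ β : ℝ, 0 < β → β < 1 → β * θ * m < (2 * (m / 2) : ℕ) → ∀ ε : ℝ, 0 < ε →
      ∀ᶠ k in atTop, Real.exp (n k * (rate ℓ m (root m (β * θ)) (β * θ) +
        θ * Real.binEntropy β - ε)) ≤ a k := by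
    intro β hβ0 hβ1 hx ε hε
    simp only [ha]
    exact eventually_le_sum hθ0 hβ0 hβ1 hε hn hJ hp
      (hlo _ _ (isPosRoot_root hm (mul_pos hβ0 hθ0) hx) (mul_pos hβ0 hθ0) hx)
  have hterm : ∀ β : ℝ, 0 < β → β * θ * m < (2 * (m / 2) : ℕ) →
      q m ((ℓ : ℝ) / m) (β * θ) + ((θ * h₂ β : ℝ) : EReal) =
      (((rate ℓ m (root m (β * θ)) (β * θ) + θ * Real.binEntropy β) / Real.log 2 : ℝ) :
        EReal) := by
    intro β hβ0 hx
    rw [q_eq hm (mul_pos hβ0 hθ0) hx, ← EReal.coe_add, h₂]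
    congr 1
    field_simp
  -- At β = 1/2 a root always exists: θ ≤ 1 and m < 4⌊m/2⌋ for m ≥ 2.
  have hpos : ∀ᶠ k in atTop, 0 < a k := by
    have hx : 1 / 2 * θ * m < (2 * (m / 2) : ℕ) := by
      have : m < 2 * (2 * (m / 2)) := by omega
      have : (m : ℝ) < 2 * (2 * (m / 2) : ℕ) := by exact_mod_cast this
      nlinarith
    filter_upwards [hlower (1 / 2) (by norm_num) (by norm_num) hx 1 one_pos] with k hk
    exact (Real.exp_pos _).trans_le hk
  have hn1 := hn.eventually (eventually_ge_atTop 1)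
  refine ⟨hpos, tendsto_order.2 ⟨fun b hb => ?_, fun b hb => ?_⟩⟩
  · rw [f] at hb
    obtain ⟨β, hb⟩ := lt_iSup_iff.1 hb
    obtain ⟨⟨hβ0, hβ1⟩, hb⟩ := lt_iSup_iff.1 hb
    have hx : β * θ * m < (2 * (m / 2) : ℕ) := by
      rw [mul_lt_two_mul_half (by omega)]
      refine ⟨by nlinarith, fun h => ?_⟩
      rw [q, if_pos h, EReal.bot_add] at hb
      exact not_lt_bot hb
    rw [hterm β hβ0 hx] at hb
    obtain ⟨v, hbv, hv⟩ := EReal.lt_iff_exists_real_btwn.1 hb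
    rw [EReal.coe_lt_coe_iff, lt_div_iff₀ hl] at hv
    filter_upwards [hlower β hβ0 hβ1 hx _ (sub_pos.2 hv), hn1, hpos] with k hk hnk hak
    have hn0 : (0 : ℝ) < n k := by exact_mod_cast hnk
    refine hbv.trans_le (EReal.coe_le_coe_iff.2 ?_)
    have h1 := (Real.le_log_iff_exp_le hak).2 hk
    rw [sub_sub_cancel] at h1
    rw [Real.logb, one_div_mul_eq_div, le_div_iff₀ hn0, le_div_iff₀ hl]
    linarith
  -- The chain f < c < c₁ < c₂ < b: c bounds the exponents at the roots, c₁ those at all relative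
  -- weights after choosing t, and c₂ that of the whole sum.
  · obtain ⟨c, hc, hcb⟩ := EReal.lt_iff_exists_real_btwn.1 hb
    obtain ⟨c₂, hc₂, hc₂b⟩ := EReal.lt_iff_exists_real_btwn.1 hcb
    obtain ⟨c₁, hc₁, hc₁b⟩ := EReal.lt_iff_exists_real_btwn.1 hc₂
    rw [EReal.coe_lt_coe_iff] at hc₁ hc₁b
    have H : ∀ β : ℝ, 0 < β → β < 1 → β * θ * m < (2 * (m / 2) : ℕ) →
        rate ℓ m (root m (β * θ)) (β * θ) + θ * Real.binEntropy β ≤ c * Real.log 2 := by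
      intro β hβ0 hβ1 hx
      have h1 : _ ≤ f ℓ m θ := le_iSup₂ (f := fun β (_ : β ∈ Set.Ioo (0 : ℝ) 1) =>
        (q m ((ℓ : ℝ) / (m : ℝ)) (β * θ) + ((θ * h₂ β : ℝ) : EReal))) β ⟨hβ0, hβ1⟩
      rw [hterm β hβ0 hx] at h1
      have h2 := h1.trans hc.le
      rwa [EReal.coe_le_coe_iff, div_le_iff₀ hl] at h2
    have hrate : ∀ y : ℝ, 0 ≤ y → y ≤ 1 →
        ∃ t, 0 < t ∧ rate ℓ m t (θ * y) + θ * Real.binEntropy y < c₁ * Real.log 2 :=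
      fun y hy0 hy1 => exists_rate_lt hm hℓ hθ0 hθ1 (mul_lt_mul_of_pos_right hc₁ hl) H hy0 hy1
    filter_upwards [eventually_sum_le (mul_lt_mul_of_pos_right hc₁b hl) hn hJ hup hrate, hn1, hpos]
      with k hk hnk hak
    have hn0 : (0 : ℝ) < n k := by exact_mod_cast hnk
    refine lt_of_le_of_lt (EReal.coe_le_coe_iff.2 ?_) hc₂b
    rw [← ha] at hk
    have h1 := (Real.log_le_iff_le_exp hak).2 hk
    rw [Real.logb, one_div_mul_eq_div, div_le_iff₀ hn0, div_le_iff₀ hl]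
    linarith

lemma probA_nonneg (r n : ℕ) (S : Finset (Fin n)) : 0 ≤ probA ℓ m r n S := by
  unfold probA; positivity

end Average

end LDPC

theorem lemma1 (ℓ m : ℕ) (hℓ : 3 ≤ ℓ) (hm : ℓ ≤ m) (θ : ℝ) (hθ0 : 0 < θ) (hθ1 : θ ≤ 1) :
    -- the root `t` is well defined
    (∀ β : ℝ, 0 < β → β < 1 → ¬ (Odd m ∧ 1 - 1 / (m : ℝ) ≤ β) →
      ∃! t : ℝ, LDPC.IsPosRoot m β t) ∧
    -- the ensemble `𝔸(ℓ, m)` of `r × n` matrices, `m r = ℓ n`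
    (∀ (n r : ℕ → ℕ) (J : (k : ℕ) → Finset (Fin (n k))),
      (∀ k, m * r k = ℓ * n k) → Tendsto n atTop atTop →
      Tendsto (fun k => ((J k).card : ℝ) / (n k : ℝ)) atTop (𝓝 θ) →
      (∀ᶠ k in atTop, 0 < LDPC.avgSizeA ℓ m (r k) (n k) (J k)) ∧
      Tendsto
        (fun k => ((1 / (n k : ℝ) *
          Real.logb 2 (LDPC.avgSizeA ℓ m (r k) (n k) (J k)) : ℝ) : EReal))
        atTop (𝓝 (LDPC.f ℓ m θ))) ∧
    -- the ensemble `𝔹(ℓ, m)` of length `n = m s`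
    (∀ (s : ℕ → ℕ) (J : (k : ℕ) → Finset (Fin (m * s k))),
      Tendsto s atTop atTop →
      Tendsto (fun k => ((J k).card : ℝ) / ((m * s k : ℕ) : ℝ)) atTop (𝓝 θ) →
      (∀ᶠ k in atTop, 0 < LDPC.avgSizeB ℓ m (s k) (J k)) ∧
      Tendsto
        (fun k => ((1 / ((m * s k : ℕ) : ℝ) *
          Real.logb 2 (LDPC.avgSizeB ℓ m (s k) (J k)) : ℝ) : EReal))
        atTop (𝓝 (LDPC.f ℓ m θ))) := by
  have hm2 : 2 ≤ m := by omega
  have hm1 : 1 ≤ m := by omega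
  have hℓ2 : 2 ≤ ℓ := by omega
  have hℓ1 : 1 ≤ ℓ := by omega
  refine ⟨fun β hβ0 hβ1 h => ?_, fun n r J hnr hn hJ => ?_, fun s J hs hJ => ?_⟩
  · exact LDPC.existsUnique_isPosRoot hm2 hβ0 ((LDPC.mul_lt_two_mul_half hm1).2 ⟨hβ1, h⟩)
  · refine LDPC.tendsto_log_average hℓ1 hm2 hθ0 hθ1 hn hJ
      (p := fun k S => LDPC.probA ℓ m (r k) (n k) S) (fun _ _ => LDPC.probA_nonneg _ _ _)
      (fun ε hε => ?_) (fun x t ht hx0 hx δ hδ ε hε => ?_) fun k => LDPC.avgSizeA_eq (J k)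
    · filter_upwards [hn.eventually (LDPC.probA_upper hm1 hℓ2 hε)] with k hk
      exact hk (r k) (hnr k)
    · filter_upwards [hn.eventually (LDPC.probA_lower hm1 hℓ2 ht hx0 hx hδ hε)] with k hk
      exact hk (r k) (hnr k)
  · have hms : Tendsto (fun k => m * s k) atTop atTop := hs.const_mul_atTop' (by omega)
    refine LDPC.tendsto_log_average hℓ1 hm2 hθ0 hθ1 hms hJ
      (p := fun k S => LDPC.probB ℓ m (s k) S.card) (fun _ _ => by unfold LDPC.probB; positivity)
      (fun ε hε => hs.eventually (LDPC.probB_upper hm1 hε))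
      (fun x t ht _ hx δ hδ ε hε => hs.eventually (LDPC.probB_lower hm1 hℓ1 ht hx hδ hε))
      fun k => LDPC.avgSizeB_eq (J k)
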